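/- For a closed set $\mathfrak F\subset\mathbb R$ and a continuous function $f$ on $\mathfrak F$, let $$\Omega_{f,\mathfrak F}(\delta)=\sup\|f(A)-f(B)\|,\qquad \delta>0,$$ where the supremum is over all (not necessarily bounded) self-adjoint operators $A,B$ on a complex Hilbert space with $\sigma(A),\sigma(B)\subset\mathfrak F$ and $\|A-B\|\le\delta$ (that is, $A$ and $B$ have the same domain and $A-B$ is bounded with norm at most $\delta$). For $a>0$ let $\xi_a$ and $\eta_a$ be the restrictions of $x\mapsto|x|$ to $[-a,\infty)$ and to $[-a,a]$, and write $\Omega_{\xi_a}=\Omega_{\xi_a,[-a,\infty)}$, $\Omega_{\eta_a}=\Omega_{\eta_a,[-a,a]}$ and $\log_+t=\max\{0,\log t\}$. (1) There exist absolute constants $C_1,C_2>0$ such that for all $a>0$ and all $\delta>0$ $$C_1\,\delta\log\bigl(2+\log_+(a/\delta)\bigr)\le\Omega_{\xi_a}(\delta)\le C_2\,\delta\log\bigl(2+\log_+(a/\delta)\bigr),\qquad \Omega_{\eta_a}(\delta)\le\Omega_{\xi_a}(\delta),$$ and, whenever $0<\delta\le a$, $$C_1\,\delta\log\bigl(2+\log_+(a/\delta)\bigr)\le\Omega_{\eta_a}(\delta).$$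 (2) There exists an absolute constant $C>0$ such that for all bounded self-adjoint operators $A$ and $B$ on a complex Hilbert space $$\bigl\|\,|A|-|B|\,\bigr\|\le C\,\|A-B\|\log\left(2+\log\frac{\|A\|+\|B\|}{\|A-B\|}\right),$$ where the right-hand side is read as $0$ if $A=B$. -/

import Mathlib

open scoped ENNReal

universe u

noncomputable section

namespace OperatorModulus

/-- A projection-valued measure (resolution of the identity) on the Borel subsets of `ℝ`, acting on
the complex Hilbert space `H`. The values on non-measurable sets are irrelevant. -/
structure SpectralMeasure (H : Type u) [NormedAddCommGroup H] [InnerProductSpace ℂ H]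
    [CompleteSpace H] where
  /-- the projection attached to a Borel set -/
  proj : Set ℝ → H →L[ℂ] H
  isStarProjection : ∀ s, MeasurableSet s → IsStarProjection (proj s)
  proj_univ : proj Set.univ = 1
  proj_inter : ∀ s t, MeasurableSet s → MeasurableSet t → proj (s ∩ t) = proj s * proj t
  hasSum_proj_iUnion : ∀ s : ℕ → Set ℝ, (∀ n, MeasurableSet (s n)) →
    Pairwise (Function.onFun Disjoint s) →
      ∀ x : H, HasSum (fun n => proj (s n) x) (proj (⋃ n, s n) x)

variable {H : Type u} [NormedAddCommGroup H] [InnerProductSpace ℂ H] [CompleteSpace H]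

theorem SpectralMeasure.re_inner_nonneg (E : SpectralMeasure H) (x : H) {s : Set ℝ}
    (hs : MeasurableSet s) : 0 ≤ (inner ℂ x (E.proj s x)).re := by
  have h := (E.isStarProjection s hs).nonneg
  have h2 := ((ContinuousLinearMap.nonneg_iff_isPositive _).1 h).re_inner_nonneg_right x
  simpa using h2

theorem SpectralMeasure.proj_empty (E : SpectralMeasure H) : E.proj ∅ = 0 := by
  ext x
  have h := E.hasSum_proj_iUnion (fun _ => ∅) (fun _ => MeasurableSet.empty)
    (fun _ _ _ => by simp [Function.onFun]) x
  have h2 := h.summable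
  simpa using (summable_const_iff (E.proj ∅ x)).1 h2

/-- The finite positive Borel measure `s ↦ ⟨E(s) x, x⟩`. -/
def SpectralMeasure.scalarMeasure (E : SpectralMeasure H) (x : H) : MeasureTheory.Measure ℝ :=
  MeasureTheory.Measure.ofMeasurable
    (fun s _ => ENNReal.ofReal (inner ℂ x (E.proj s x)).re)
    (by simp [E.proj_empty])
    (by
      intro s hs hd
      have h := E.hasSum_proj_iUnion s hs hd x
      have h2 : HasSum (fun n => (inner ℂ x (E.proj (s n) x)).re)
          (inner ℂ x (E.proj (⋃ n, s n) x)).re :=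
        Complex.hasSum_re (h.mapL (innerSL ℂ x))
      rw [← h2.tsum_eq]
      exact ENNReal.ofReal_tsum_of_nonneg (fun n => E.re_inner_nonneg x (hs n)) h2.summable)

theorem SpectralMeasure.scalarMeasure_apply (E : SpectralMeasure H) (x : H) {s : Set ℝ}
    (hs : MeasurableSet s) :
    E.scalarMeasure x s = ENNReal.ofReal (inner ℂ x (E.proj s x)).re :=
  MeasureTheory.Measure.ofMeasurable_apply s hs

/-- `T = ∫ f dE` as a possibly unbounded operator: the domain of `T` is
`{x | ∫ |f|² d⟨E x, x⟩ < ∞}`, and `⟨T x, x⟩ = ∫ f d⟨E x, x⟩` for `x` in the domain. As the scalars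
are complex, the quadratic form determines `T`. -/
def IsSpectralIntegral (E : SpectralMeasure H) (f : ℝ → ℝ) (T : H →ₗ.[ℂ] H) : Prop :=
  (∀ x : H, x ∈ T.domain ↔ ∫⁻ t, ‖f t‖ₑ ^ 2 ∂(E.scalarMeasure x) < ∞) ∧
    ∀ x : T.domain, inner ℂ (x : H) (T x) = ((∫ t, f t ∂(E.scalarMeasure (x : H)) : ℝ) : ℂ)

/-- `T = f(A)`: there is a spectral measure `E` with `A = ∫ t dE(t)` and `T = ∫ f(t) dE(t)`.
By the spectral theorem a self-adjoint `A` has exactly one such `E`. -/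
def IsFunctionalCalculus (f : ℝ → ℝ) (A T : H →ₗ.[ℂ] H) : Prop :=
  ∃ E : SpectralMeasure H, IsSpectralIntegral E id A ∧ IsSpectralIntegral E f T

/-- The spectrum of a closed operator: the `z` for which `A - z` is not a bijection of the domain
of `A` onto `H`. -/
def spectrum (A : H →ₗ.[ℂ] H) : Set ℂ :=
  {z | ¬ Function.Bijective (fun x : A.domain => A x - z • (x : H))}

/-- The operator norm, in `[0, ∞]`, of a possibly unbounded operator. -/
def opNorm (T : H →ₗ.[ℂ] H) : ℝ≥0∞ :=
  ⨆ (x : T.domain) (_ : ‖(x : H)‖ ≤ 1), ‖T x‖ₑ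

/-- The operator modulus of continuity of `f` on `F ⊆ ℝ`: the supremum of `‖f(A) - f(B)‖` over
all self-adjoint, not necessarily bounded, operators `A` and `B` on a complex Hilbert space whose
spectra lie in `F` and which satisfy `‖A - B‖ ≤ δ` (`A` and `B` have the same domain and differ
there by a bounded operator of norm at most `δ`). Only the restriction of `f` to `F` matters. -/
def operatorModulus (f : ℝ → ℝ) (F : Set ℝ) (δ : ℝ) : ℝ≥0∞ :=
  sSup {r : ℝ≥0∞ | ∃ (H : Type u) (_ : NormedAddCommGroup H) (_ : InnerProductSpace ℂ H)
    (_ : CompleteSpace H) (A B fA fB : H →ₗ.[ℂ] H),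
      IsSelfAdjoint A ∧ IsSelfAdjoint B ∧
      spectrum A ⊆ Complex.ofReal '' F ∧ spectrum B ⊆ Complex.ofReal '' F ∧
      A.domain = B.domain ∧ opNorm (A - B) ≤ ENNReal.ofReal δ ∧
      IsFunctionalCalculus f A fA ∧ IsFunctionalCalculus f B fB ∧
      r = opNorm (fA - fB)}

end OperatorModulus

end

/-! Upper bound. If the spectral measures E of A and G of B live on [-a, ∞), then |A| = A - 2A₋ with
A₋ = A E([-a, 0)), a bounded operator, so it is enough to compare A₋ with B₋. Inserting projections
writes A₋ - B₋ as a compression of A - B plus two terms of the type E([0, ∞)) B₋, up to adjoints and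
exchange of A and B. Such a term is a triangular truncation. It is controlled by (m + n) ‖E(s) G(t)‖
≤ δ for s ≥ m and t ≤ -n, n ≥ 0 (`norm_proj_mul_proj_le`), which is the sharp bound for a Sylvester
equation with semibounded coefficients (`norm_le_of_sylvester`). The part of B₋ on (-δ, 0) has norm
at most δ. The interval [-a, -δ] is bisected repeatedly at the geometric mean of its endpoints: the
two diagonal blocks are mutually orthogonal, so only their maximum counts, and the two off-diagonal
blocks cost 3δ per level (`norm_proj_mul_cut_le`). Each bisection halves the logarithm of the ratio
of the endpoints, so the depth is about log log (a/δ).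

Lower bound. Let D be diagonal with eigenvalues (-1)^i 2^i, and let X solve [D, X] = K, where K is
the odd part of the Hilbert matrix, bounded by Hilbert's inequality. Eigenvalues of opposite sign
satisfy λ - μ = ±(|λ| + |μ|), so |D|X + X|D| is K up to signs and the Sylvester bound makes X
bounded. In contrast, the entries of [|D|, X] are, up to unimodular row factors, nonnegative and of
size 1/|i - j|, so its norm is at least of order log N for size 4N. The Cayley transform U of the
skew-adjoint X turns commutators into differences: D and U*DU are boundedly close while their moduli
are log N apart. As ‖D‖ is exponential in N, log N is of order log log (a/δ) after scaling.

Bounded operators. Replacing |·| by a polynomial and compressing to the finite-dimensional span of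
the powers of A and B applied to one vector reduces part (2) to diagonal operators, whose spectral
measures are explicit and to which the upper bound applies. -/

noncomputable section

namespace OperatorModulus

/-! ### Norm estimates for bounded operators and the Sylvester equation -/

section BoundedOperators

variable {H : Type*} [NormedAddCommGroup H] [InnerProductSpace ℂ H]

/-- A symmetric bounded operator is bounded by any bound of its quadratic form. -/
theorem norm_le_of_abs_re_inner_le {T : H →L[ℂ] H} (hT : ∀ x y, inner ℂ (T x) y = inner ℂ x (T y))
    {R : ℝ} (hR : 0 ≤ R) (h : ∀ x, |(inner ℂ x (T x)).re| ≤ R * ‖x‖ ^ 2) : ‖T‖ ≤ R := by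
  have key : ∀ x y, (inner ℂ y (T x)).re * 2 ≤ R * (‖x‖ ^ 2 + ‖y‖ ^ 2) := by
    intro x y
    have h1 := (abs_le.1 (h (x + y))).2
    have h2 := (abs_le.1 (h (x - y))).1
    have e : (inner ℂ x (T y)).re = (inner ℂ y (T x)).re := by
      rw [← hT, ← inner_conj_symm, Complex.conj_re]
    have hp := parallelogram_law_with_norm ℂ x y
    simp only [map_add, map_sub, inner_add_left, inner_add_right, inner_sub_left, inner_sub_right,
      Complex.add_re, Complex.sub_re] at h1 h2
    nlinarith
  refine T.opNorm_le_bound hR fun x => ?_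
  rcases eq_or_ne (T x) 0 with h0 | h0
  · rw [h0, norm_zero]; positivity
  have hpos : 0 < ‖T x‖ := norm_pos_iff.2 h0
  -- Rescaling `T x` to the length of `x` balances the two squares in `key`.
  have h1 := key x (((‖x‖ / ‖T x‖ : ℝ) : ℂ) • T x)
  rw [inner_smul_left, Complex.conj_ofReal, Complex.re_ofReal_mul, norm_smul,
    Complex.norm_real, Real.norm_of_nonneg (by positivity), div_mul_cancel₀ _ hpos.ne'] at h1
  have h2 : (inner ℂ (T x) (T x)).re = ‖T x‖ ^ 2 := by
    rw [inner_self_eq_norm_sq_to_K]; norm_cast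
  rw [h2] at h1
  have h3 : ‖x‖ / ‖T x‖ * ‖T x‖ ^ 2 = ‖x‖ * ‖T x‖ := by field_simp
  rw [h3] at h1
  rcases eq_or_ne x 0 with rfl | hx
  · simp
  have hxp : 0 < ‖x‖ := norm_pos_iff.2 hx
  nlinarith

/-- A sum of two operators with orthogonal ranges and orthogonal supports. -/
theorem norm_add_le_of_orthogonal {T₁ T₂ q₁ q₂ : H →L[ℂ] H} {c : ℝ} (hc : 0 ≤ c)
    (ho : ∀ x y, inner ℂ (T₁ x) (T₂ y) = 0) (h₁ : T₁ * q₁ = T₁) (h₂ : T₂ * q₂ = T₂)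
    (hq : ∀ x, ‖q₁ x‖ ^ 2 + ‖q₂ x‖ ^ 2 ≤ ‖x‖ ^ 2) (b₁ : ‖T₁‖ ≤ c) (b₂ : ‖T₂‖ ≤ c) :
    ‖T₁ + T₂‖ ≤ c := by
  refine ContinuousLinearMap.opNorm_le_bound _ hc fun x => ?_
  have e : ‖(T₁ + T₂) x‖ ^ 2 = ‖T₁ x‖ ^ 2 + ‖T₂ x‖ ^ 2 := by
    rw [add_apply, pow_two, pow_two, pow_two]
    exact norm_add_sq_eq_norm_sq_add_norm_sq_of_inner_eq_zero _ _ (ho x x)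
  have n₁ : ‖T₁ x‖ ≤ c * ‖q₁ x‖ := by
    nth_rw 1 [← h₁]; exact (T₁.le_opNorm _).trans (mul_le_mul_of_nonneg_right b₁ (norm_nonneg _))
  have n₂ : ‖T₂ x‖ ≤ c * ‖q₂ x‖ := by
    nth_rw 1 [← h₂]; exact (T₂.le_opNorm _).trans (mul_le_mul_of_nonneg_right b₂ (norm_nonneg _))
  refine le_of_sq_le_sq ?_ (by positivity)
  calc ‖(T₁ + T₂) x‖ ^ 2 ≤ (c * ‖q₁ x‖) ^ 2 + (c * ‖q₂ x‖) ^ 2 := by rw [e]; gcongr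
    _ = c ^ 2 * (‖q₁ x‖ ^ 2 + ‖q₂ x‖ ^ 2) := by ring
    _ ≤ c ^ 2 * ‖x‖ ^ 2 := by gcongr; exact hq x
    _ = _ := by ring

/-- The solution of the Sylvester equation `M Z + Z N = K` with `M ≥ m` and `N ≥ n`. -/
theorem norm_le_of_sylvester [CompleteSpace H] {M N Z K : H →L[ℂ] H} {m n : ℝ} (hn : 0 ≤ n)
    (hM : ∀ x, m * ‖x‖ ^ 2 ≤ (inner ℂ x (M x)).re) (hN : ∀ x, n * ‖x‖ ^ 2 ≤ (inner ℂ x (N x)).re)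
    (h : M * Z + Z * N = K) : (m + n) * ‖Z‖ ≤ ‖K‖ := by
  set z := ‖Z‖ with hz
  rcases eq_or_ne z 0 with h0 | h0
  · rw [h0]; simp
  have hzp : 0 < z := lt_of_le_of_ne (norm_nonneg _) h0.symm
  have key : ∀ x, ‖x‖ ≤ 1 →
      (m + n) * ‖Z x‖ ^ 2 - ‖N‖ * (z * √(z ^ 2 - ‖Z x‖ ^ 2)) ≤ z * ‖K‖ := by
    intro x hx
    -- The vector `w` measures the failure of `x` to be an eigenvector of Z*Z for z². It is small
    -- when ‖Z x‖ is close to z, and replacing Z*Z x by z² x turns the term ⟨Z x, Z N x⟩ into z² ⟨x,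
    -- N x⟩.
    set w := ((z ^ 2 : ℝ) : ℂ) • x - Z.adjoint (Z x) with hw
    have hZx : ‖Z x‖ ≤ z * ‖x‖ := Z.le_opNorm x
    have hZ1 : ‖Z x‖ ≤ z := hZx.trans (by nlinarith)
    have hw2 : ‖w‖ ≤ z * √(z ^ 2 - ‖Z x‖ ^ 2) := by
      refine le_of_sq_le_sq ?_ (by positivity)
      rw [mul_pow, Real.sq_sqrt (by nlinarith [norm_nonneg (Z x)]), hw, @norm_sub_sq ℂ,
        inner_smul_left, Complex.conj_ofReal, ContinuousLinearMap.adjoint_inner_right,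
        inner_self_eq_norm_sq_to_K, norm_smul, Complex.norm_real, Real.norm_of_nonneg (by positivity)]
      have h3 : ‖Z.adjoint (Z x)‖ ≤ z * ‖Z x‖ := by
        have := Z.adjoint.le_opNorm (Z x)
        rwa [LinearIsometryEquiv.norm_map] at this
      have h4 : ‖Z.adjoint (Z x)‖ ^ 2 ≤ z ^ 2 * ‖Z x‖ ^ 2 := by
        rw [← mul_pow]; gcongr
      have h5 : RCLike.re (((z ^ 2 : ℝ) : ℂ) * ((‖Z x‖ : ℝ) : ℂ) ^ 2) = z ^ 2 * ‖Z x‖ ^ 2 := by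
        norm_cast
      have h7 : (z ^ 2 * ‖x‖) ^ 2 ≤ z ^ 2 * z ^ 2 := by
        have : ‖x‖ ^ 2 ≤ 1 := pow_le_one₀ (norm_nonneg _) hx
        have : 0 ≤ z ^ 2 * z ^ 2 := by positivity
        nlinarith
      have h6 := h5
      simp only [RCLike.ofReal_eq_complex_ofReal] at *
      rw [h6]
      nlinarith
    have e1 : (inner ℂ (Z x) (K x)).re = (inner ℂ (Z x) (M (Z x))).re
        + z ^ 2 * (inner ℂ x (N x)).re - (inner ℂ w (N x)).re := by
      have : inner ℂ (Z x) (Z (N x)) = inner ℂ (Z.adjoint (Z x)) (N x) := by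
        rw [ContinuousLinearMap.adjoint_inner_left]
      rw [← h]
      simp only [add_apply, mul_apply_eq_comp, inner_add_right,
        this, hw, inner_sub_left, inner_smul_left, Complex.conj_ofReal, Complex.add_re,
        Complex.sub_re, Complex.re_ofReal_mul]
      ring
    have e2 : (inner ℂ (Z x) (K x)).re ≤ z * ‖K‖ := by
      refine (Complex.re_le_norm _).trans ((norm_inner_le_norm _ _).trans ?_)
      have := K.le_opNorm x
      have : ‖K x‖ ≤ ‖K‖ := this.trans (by nlinarith [norm_nonneg K])
      gcongr
    have e3 : (inner ℂ w (N x)).re ≤ ‖N‖ * (z * √(z ^ 2 - ‖Z x‖ ^ 2)) := by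
      refine (Complex.re_le_norm _).trans ((norm_inner_le_norm _ _).trans ?_)
      have := N.le_opNorm x
      have : ‖N x‖ ≤ ‖N‖ := this.trans (by nlinarith [norm_nonneg N])
      rw [mul_comm]
      gcongr
    have e4 : n * ‖Z x‖ ^ 2 ≤ z ^ 2 * (inner ℂ x (N x)).re := by
      have a1 : ‖Z x‖ ^ 2 ≤ z ^ 2 * ‖x‖ ^ 2 := by rw [← mul_pow]; gcongr
      have a2 : 0 ≤ z ^ 2 := by positivity
      nlinarith [hN x]
    nlinarith [hM (Z x)]
  suffices hs : (m + n) * z ^ 2 ≤ z * ‖K‖ by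
    rw [pow_two, ← mul_assoc, mul_comm z] at hs
    exact le_of_mul_le_mul_right hs hzp
  -- The norm need not be attained: along near-maximizers the square-root error in `key` tends to 0,
  -- so the bound follows by continuity at z.
  by_contra! hcon
  have hcont : ContinuousAt (fun s : ℝ => (m + n) * s ^ 2 - ‖N‖ * (z * √(z ^ 2 - s ^ 2))) z := by
    fun_prop
  have hev := hcont.eventually (lt_mem_nhds (a := z * ‖K‖) (by simpa using hcon))
  obtain ⟨ε, hε, hball⟩ := Metric.eventually_nhds_iff.1 hev
  obtain ⟨x, hx, hxs⟩ := Z.exists_lt_apply_of_lt_opNorm (show z - ε < ‖Z‖ by linarith)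
  have hxz : ‖Z x‖ ≤ z := (Z.le_opNorm x).trans (by nlinarith)
  have := hball (y := ‖Z x‖) (by rw [Real.dist_eq, abs_lt]; constructor <;> linarith)
  linarith [key x hx.le]

end BoundedOperators

/-! ### Algebra of spectral projections and scalar measures -/

section Projections

open MeasureTheory

variable {H : Type u} [NormedAddCommGroup H] [InnerProductSpace ℂ H] [CompleteSpace H]
  (E : SpectralMeasure H) {s t : Set ℝ}

namespace SpectralMeasure

theorem proj_proj (hs : MeasurableSet s) (ht : MeasurableSet t) (x : H) :
    E.proj s (E.proj t x) = E.proj (s ∩ t) x := by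
  rw [E.proj_inter s t hs ht]; rfl

theorem proj_proj_self (hs : MeasurableSet s) (x : H) : E.proj s (E.proj s x) = E.proj s x := by
  rw [E.proj_proj hs hs, Set.inter_self]

theorem inner_proj_left (hs : MeasurableSet s) (x y : H) :
    inner ℂ (E.proj s x) y = inner ℂ x (E.proj s y) := by
  rw [← ContinuousLinearMap.adjoint_inner_right, ← ContinuousLinearMap.star_eq_adjoint,
    (E.isStarProjection s hs).isSelfAdjoint.star_eq]

theorem proj_union (hs : MeasurableSet s) (ht : MeasurableSet t) (hd : Disjoint s t) :
    E.proj (s ∪ t) = E.proj s + E.proj t := by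
  ext x
  set f : ℕ → Set ℝ := fun n => if n = 0 then s else if n = 1 then t else ∅ with hf
  have hm : ∀ n, MeasurableSet (f n) := by
    intro n; simp only [hf]; split_ifs <;> simp [hs, ht]
  have hdis : Pairwise (Function.onFun Disjoint f) := by
    intro i j hij
    simp only [Function.onFun, hf]
    split_ifs <;> first | omega | simp [hd.symm]
  have hU : ⋃ n, f n = s ∪ t := by
    ext r
    simp only [Set.mem_iUnion, Set.mem_union, hf]
    constructor
    · rintro ⟨n, hn⟩
      split_ifs at hn
      · exact Or.inl hn
      · exact Or.inr hn
      · exact hn.elim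
    · rintro (h | h)
      · exact ⟨0, by simpa using h⟩
      · exact ⟨1, by simpa using h⟩
  have h1 := E.hasSum_proj_iUnion f hm hdis x
  rw [hU] at h1
  have h2 : HasSum (fun n => E.proj (f n) x) (∑ n ∈ Finset.range 2, E.proj (f n) x) :=
    hasSum_sum_of_ne_finset_zero (fun n hn => by
      have : f n = ∅ := by
        simp only [Finset.mem_range] at hn
        simp only [hf]; rw [if_neg (by omega), if_neg (by omega)]
      rw [this, E.proj_empty]; rfl)
  rw [h1.unique h2]
  simp [Finset.sum_range_succ, hf]

theorem proj_compl (hs : MeasurableSet s) : E.proj sᶜ = 1 - E.proj s := by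
  have h := E.proj_union hs hs.compl disjoint_compl_right
  rw [Set.union_compl_self, E.proj_univ] at h
  rw [h]; abel

theorem proj_add_proj_compl (hs : MeasurableSet s) (x : H) : E.proj s x + E.proj sᶜ x = x := by
  rw [E.proj_compl hs]; simp

theorem inner_proj_self (hs : MeasurableSet s) (x : H) :
    inner ℂ x (E.proj s x) = ((‖E.proj s x‖ ^ 2 : ℝ) : ℂ) := by
  rw [← E.proj_proj_self hs, ← E.inner_proj_left hs, inner_self_eq_norm_sq_to_K]
  simp [E.proj_proj_self hs]

theorem inner_proj_proj_of_disjoint (hs : MeasurableSet s) (ht : MeasurableSet t)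
    (hd : Disjoint s t) (x y : H) : inner ℂ (E.proj s x) (E.proj t y) = 0 := by
  rw [E.inner_proj_left hs, E.proj_proj hs ht, hd.inter_eq, E.proj_empty]; simp

theorem norm_proj_sq_add (hs : MeasurableSet s) (ht : MeasurableSet t) (hd : Disjoint s t)
    (x : H) : ‖E.proj s x‖ ^ 2 + ‖E.proj t x‖ ^ 2 = ‖E.proj (s ∪ t) x‖ ^ 2 := by
  rw [E.proj_union hs ht hd, add_apply, pow_two, pow_two, pow_two]
  exact (norm_add_sq_eq_norm_sq_add_norm_sq_of_inner_eq_zero _ _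
    (E.inner_proj_proj_of_disjoint hs ht hd x x)).symm

theorem norm_proj_le (hs : MeasurableSet s) (x : H) : ‖E.proj s x‖ ≤ ‖x‖ := by
  refine le_of_sq_le_sq ?_ (norm_nonneg _)
  have h := E.norm_proj_sq_add hs hs.compl disjoint_compl_right x
  rw [Set.union_compl_self, E.proj_univ, one_apply_eq_self] at h
  nlinarith [sq_nonneg ‖E.proj sᶜ x‖]

theorem scalarMeasure_apply' (x : H) (hs : MeasurableSet s) :
    E.scalarMeasure x s = ENNReal.ofReal (‖E.proj s x‖ ^ 2) := by
  rw [E.scalarMeasure_apply x hs, E.inner_proj_self hs, Complex.ofReal_re]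

theorem scalarMeasure_univ (x : H) :
    E.scalarMeasure x Set.univ = ENNReal.ofReal (‖x‖ ^ 2) := by
  rw [E.scalarMeasure_apply' x MeasurableSet.univ, E.proj_univ]; rfl

instance (x : H) : IsFiniteMeasure (E.scalarMeasure x) :=
  ⟨by rw [E.scalarMeasure_univ]; exact ENNReal.ofReal_lt_top⟩

theorem measureReal_scalarMeasure (x : H) (hs : MeasurableSet s) :
    (E.scalarMeasure x).real s = ‖E.proj s x‖ ^ 2 := by
  rw [Measure.real, E.scalarMeasure_apply' x hs, ENNReal.toReal_ofReal (by positivity)]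

theorem scalarMeasure_proj (x : H) (hs : MeasurableSet s) :
    E.scalarMeasure (E.proj s x) = (E.scalarMeasure x).restrict s := by
  ext r hr
  rw [E.scalarMeasure_apply' _ hr, Measure.restrict_apply hr, E.scalarMeasure_apply' _ (hr.inter hs),
    E.proj_proj hr hs]

/-- The two summands stay orthogonal under every E(r), so the phase `c` disappears. This
independence of `c` is what yields off-diagonal information from a quadratic form. -/
theorem scalarMeasure_add_smul (hs : MeasurableSet s) (x y : H) {c : ℂ} (hc : ‖c‖ = 1) :
    E.scalarMeasure (E.proj s x + c • E.proj sᶜ y) =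
      E.scalarMeasure (E.proj s x) + E.scalarMeasure (E.proj sᶜ y) := by
  ext r hr
  rw [Measure.add_apply]
  simp only [E.scalarMeasure_apply' _ hr]
  rw [← ENNReal.ofReal_add (by positivity) (by positivity)]
  congr 1
  rw [map_add, map_smul, E.proj_proj hr hs, E.proj_proj hr hs.compl]
  have h0 : inner ℂ (E.proj (r ∩ s) x) (c • E.proj (r ∩ sᶜ) y) = 0 := by
    rw [inner_smul_right, E.inner_proj_proj_of_disjoint (hr.inter hs) (hr.inter hs.compl), mul_zero]
    exact (disjoint_compl_right.mono Set.inter_subset_right Set.inter_subset_right)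
  rw [pow_two, norm_add_sq_eq_norm_sq_add_norm_sq_of_inner_eq_zero _ _ h0, norm_smul, hc]
  ring

/-- Continuity of the projections along `[0, n)`. -/
theorem tendsto_proj_Ico (x : H) :
    Filter.Tendsto (fun n : ℕ => E.proj (Set.Ico 0 (n : ℝ)) x) Filter.atTop
      (nhds (E.proj (Set.Ici 0) x)) := by
  have hdis : Pairwise (Function.onFun Disjoint (fun n : ℕ => Set.Ico (n : ℝ) (n + 1))) := by
    intro i j hij
    refine Set.disjoint_left.2 fun r hr hr' => hij ?_
    have h1 : (i : ℝ) < j + 1 := hr.1.trans_lt hr'.2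
    have h2 : (j : ℝ) < i + 1 := hr'.1.trans_lt hr.2
    norm_cast at h1 h2
    omega
  have h := E.hasSum_proj_iUnion _ (fun n => measurableSet_Ico) hdis x
  have hU : ⋃ n : ℕ, Set.Ico (n : ℝ) (n + 1) = Set.Ici 0 := by
    ext r
    simp only [Set.mem_iUnion, Set.mem_Ico, Set.mem_Ici]
    constructor
    · rintro ⟨n, hn, -⟩
      exact (Nat.cast_nonneg n).trans hn
    · intro hr
      exact ⟨⌊r⌋₊, Nat.floor_le hr, Nat.lt_floor_add_one r⟩
  rw [hU] at h
  refine h.tendsto_sum_nat.congr fun n => ?_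
  induction n with
  | zero => simp [E.proj_empty]
  | succ n ih =>
    rw [Finset.sum_range_succ, ih, Nat.cast_succ,
      ← Set.Ico_union_Ico_eq_Ico (Nat.cast_nonneg n) (by linarith : (n : ℝ) ≤ n + 1),
      E.proj_union measurableSet_Ico measurableSet_Ico]
    · rfl
    · exact Set.disjoint_left.2 fun r hr hr' => absurd hr.2 (not_lt.2 hr'.1)

end SpectralMeasure

end Projections

/-! ### Spectral integrals recovered from their quadratic forms -/

section SpectralIntegral

open MeasureTheory

/-- A linear map on a complex subspace is determined by its quadratic form. -/
theorem inner_eq_zero_of_inner_self_eq_zero {H : Type*} [NormedAddCommGroup H]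
    [InnerProductSpace ℂ H] {D : Submodule ℂ H} (T : D →ₗ[ℂ] H)
    (h : ∀ x : D, inner ℂ (x : H) (T x) = 0) (x y : D) : inner ℂ (y : H) (T x) = 0 := by
  have h1 := h (x + y)
  have h2 := h (x + Complex.I • y)
  simp only [Submodule.coe_add, Submodule.coe_smul, map_add, map_smul, inner_add_left,
    inner_add_right, inner_smul_left, inner_smul_right, h, Complex.conj_I] at h1 h2
  have h3 : Complex.I * (Complex.I * inner ℂ (x : H) (T y) - Complex.I * inner ℂ (y : H) (T x)) = 0 := by
    linear_combination Complex.I * h2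
  have hI := Complex.I_mul_I
  have h4 : inner ℂ (y : H) (T x) - inner ℂ (x : H) (T y) = 0 := by
    linear_combination h3 + (inner ℂ (y : H) (T x) - inner ℂ (x : H) (T y)) * hI
  linear_combination (h1 + h4) / 2

theorem eq_zero_of_dense_of_inner {H : Type*} [NormedAddCommGroup H]
    [InnerProductSpace ℂ H] {D : Submodule ℂ H} (hD : Dense (D : Set H)) {z : H}
    (h : ∀ y : D, inner ℂ (y : H) z = 0) : z = 0 :=
  hD.eq_zero_of_inner_left (𝕜 := ℂ) (fun y hy => by
    rw [← inner_conj_symm, h ⟨y, hy⟩, map_zero])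

variable {H : Type u} [NormedAddCommGroup H] [InnerProductSpace ℂ H] [CompleteSpace H]

theorem symmetric_of_isSelfAdjoint {A : H →ₗ.[ℂ] H} (hA : IsSelfAdjoint A) (x y : A.domain) :
    inner ℂ (A x) (y : H) = inner ℂ (x : H) (A y) := by
  have h := LinearPMap.adjoint_isFormalAdjoint (T := A) hA.dense_domain
  rw [LinearPMap.isSelfAdjoint_def.1 hA] at h
  exact h x y

variable {E : SpectralMeasure H} {f : ℝ → ℝ} {T A : H →ₗ.[ℂ] H} {s t : Set ℝ}

theorem IsSpectralIntegral.memLp (h : IsSpectralIntegral E f T) (hf : Measurable f) {x : H}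
    (hx : x ∈ T.domain) : MemLp f 2 (E.scalarMeasure x) := by
  refine ⟨hf.aestronglyMeasurable, ?_⟩
  rw [eLpNorm_lt_top_iff_lintegral_rpow_enorm_lt_top (by simp) (by simp)]
  simpa using (h.1 x).1 hx

theorem IsSpectralIntegral.integrable (h : IsSpectralIntegral E f T) (hf : Measurable f) {x : H}
    (hx : x ∈ T.domain) : Integrable f (E.scalarMeasure x) :=
  (h.memLp hf hx).integrable (by norm_num)

theorem IsSpectralIntegral.proj_mem (h : IsSpectralIntegral E f T) (hs : MeasurableSet s) {x : H}
    (hx : x ∈ T.domain) : E.proj s x ∈ T.domain := by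
  rw [h.1, E.scalarMeasure_proj x hs]
  exact (setLIntegral_le_lintegral _ _).trans_lt ((h.1 x).1 hx)

theorem IsSpectralIntegral.proj_mem_of_bounded (h : IsSpectralIntegral E f T)
    (hs : MeasurableSet s) {R : ℝ} (hR : ∀ r ∈ s, |f r| ≤ R) (x : H) : E.proj s x ∈ T.domain := by
  rw [h.1, E.scalarMeasure_proj x hs]
  calc ∫⁻ r in s, ‖f r‖ₑ ^ 2 ∂(E.scalarMeasure x)
      ≤ ∫⁻ _ in s, ENNReal.ofReal R ^ 2 ∂(E.scalarMeasure x) := by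
        refine setLIntegral_mono measurable_const fun r hr => ?_
        gcongr
        rw [← ofReal_norm, Real.norm_eq_abs]
        exact ENNReal.ofReal_le_ofReal (hR r hr)
    _ < ∞ := by
        rw [setLIntegral_const]
        exact ENNReal.mul_lt_top (by simp) (measure_lt_top _ _)

/-- The spectral subspaces of complementary sets are orthogonal for the form of `T`. -/
theorem IsSpectralIntegral.inner_proj_apply_proj_compl (h : IsSpectralIntegral E f T)
    (hf : Measurable f) (hs : MeasurableSet s) {x y : H} (hx : E.proj s x ∈ T.domain)
    (hy : E.proj sᶜ y ∈ T.domain) :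
    inner ℂ (E.proj s x) (T ⟨_, hy⟩) = 0 ∧ inner ℂ (E.proj sᶜ y) (T ⟨_, hx⟩) = 0 := by
  -- The integral of f does not see the phase, so the cross terms cancel for every unimodular c; the
  -- values 1 and i separate them.
  have key : ∀ c : ℂ, ‖c‖ = 1 → c * inner ℂ (E.proj s x) (T ⟨_, hy⟩)
      + (starRingEnd ℂ) c * inner ℂ (E.proj sᶜ y) (T ⟨_, hx⟩) = 0 := by
    intro c hc
    have h1 := h.2 (⟨_, hx⟩ + c • ⟨_, hy⟩)
    have h2 := h.2 ⟨_, hx⟩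
    have h3 := h.2 ⟨_, hy⟩
    simp only [Submodule.coe_add, Submodule.coe_smul] at h1
    rw [E.scalarMeasure_add_smul hs x y hc,
      integral_add_measure (h.integrable hf hx) (h.integrable hf hy), Complex.ofReal_add, ← h2, ← h3,
      LinearPMap.map_add, LinearPMap.map_smul] at h1
    simp only [inner_add_left, inner_add_right, inner_smul_left, inner_smul_right] at h1
    have hcc : (starRingEnd ℂ) c * c = 1 := by
      rw [Complex.conj_mul', hc]; norm_num
    linear_combination h1 - inner ℂ (E.proj sᶜ y) (T ⟨_, hy⟩) * hcc
  have h1 := key 1 (by simp)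
  have h2 := key Complex.I (by simp)
  rw [map_one] at h1
  rw [Complex.conj_I] at h2
  have hI := Complex.I_mul_I
  constructor
  · linear_combination h1 / 2 - Complex.I * h2 / 2 +
      (inner ℂ (E.proj s x) (T ⟨_, hy⟩) - inner ℂ (E.proj sᶜ y) (T ⟨_, hx⟩)) / 2 * hI
  · linear_combination h1 / 2 + Complex.I * h2 / 2 -
      (inner ℂ (E.proj s x) (T ⟨_, hy⟩) - inner ℂ (E.proj sᶜ y) (T ⟨_, hx⟩)) / 2 * hI

/-- Tested against y in the dense domain, both sides reduce to ⟨E(s) y, T E(s) x⟩, because the form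
of T does not couple the ranges of E(s) and E(sᶜ). -/
theorem IsSpectralIntegral.apply_proj (h : IsSpectralIntegral E f T) (hf : Measurable f)
    (hT : Dense (T.domain : Set H)) (hs : MeasurableSet s) {x : H} (hx : x ∈ T.domain) :
    T ⟨E.proj s x, h.proj_mem hs hx⟩ = E.proj s (T ⟨x, hx⟩) := by
  rw [← sub_eq_zero]
  refine eq_zero_of_dense_of_inner hT fun y => ?_
  have e : T ⟨x, hx⟩ = T ⟨_, h.proj_mem hs hx⟩ + T ⟨_, h.proj_mem hs.compl hx⟩ := by
    rw [← LinearPMap.map_add]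
    congr 1
    ext
    exact (E.proj_add_proj_compl hs x).symm
  have h1 := (h.inner_proj_apply_proj_compl hf hs (h.proj_mem hs y.2) (h.proj_mem hs.compl hx)).1
  have h2 := (h.inner_proj_apply_proj_compl hf hs (h.proj_mem hs hx) (h.proj_mem hs.compl y.2)).2
  have e2 : (y : H) = E.proj s y + E.proj sᶜ y := (E.proj_add_proj_compl hs _).symm
  rw [inner_sub_right, ← E.inner_proj_left hs, e, inner_add_right, h1, add_zero]
  nth_rw 1 [e2]
  rw [inner_add_left, h2]
  ring

end SpectralIntegral

/-! ### The bounded pieces A E(s) -/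

section Cut

open MeasureTheory

variable {H : Type u} [NormedAddCommGroup H] [InnerProductSpace ℂ H] [CompleteSpace H]

open Classical in
/-- The bounded operator `A E(s)`, for a bounded Borel set `s`. -/
def cut (E : SpectralMeasure H) (A : H →ₗ.[ℂ] H) (s : Set ℝ) : H →L[ℂ] H :=
  if h : ∃ T : H →L[ℂ] H, ∀ x, ∃ hx : E.proj s x ∈ A.domain, T x = A ⟨E.proj s x, hx⟩
  then h.choose else 0

variable {E : SpectralMeasure H} {A : H →ₗ.[ℂ] H} {s t : Set ℝ} {R : ℝ}

theorem proj_mem_domain (hE : IsSpectralIntegral E id A) (hs : MeasurableSet s)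
    (hR : s ⊆ Set.Icc (-R) R) (x : H) : E.proj s x ∈ A.domain :=
  hE.proj_mem_of_bounded hs (fun _ hr => abs_le.2 (hR hr)) x

theorem apply_proj_proj (hA : IsSelfAdjoint A) (hE : IsSpectralIntegral E id A)
    (hs : MeasurableSet s) (x : H) (hx : E.proj s x ∈ A.domain) :
    E.proj s (A ⟨E.proj s x, hx⟩) = A ⟨E.proj s x, hx⟩ := by
  rw [← hE.apply_proj measurable_id hA.dense_domain hs hx]
  congr 1
  ext
  exact E.proj_proj_self hs x

/-- Since A E(s) = E(s) A E(s) is symmetric and everywhere defined, it is bounded by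
Hellinger–Toeplitz. -/
theorem exists_cut_apply (hA : IsSelfAdjoint A) (hE : IsSpectralIntegral E id A)
    (hs : MeasurableSet s) (hR : s ⊆ Set.Icc (-R) R) :
    ∃ T : H →L[ℂ] H, ∀ x, ∃ hx : E.proj s x ∈ A.domain, T x = A ⟨E.proj s x, hx⟩ := by
  have hmem := proj_mem_domain hE hs hR
  let L : H →ₗ[ℂ] H := A.toFun ∘ₗ ((E.proj s).toLinearMap.codRestrict A.domain hmem)
  have hLa : ∀ x, L x = A ⟨E.proj s x, hmem x⟩ := fun _ => rfl
  have hL : L.IsSymmetric := by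
    intro x y
    rw [hLa, hLa, ← apply_proj_proj hA hE hs x, ← apply_proj_proj hA hE hs y,
      E.inner_proj_left hs, ← E.inner_proj_left hs x]
    exact symmetric_of_isSelfAdjoint hA ⟨_, hmem x⟩ ⟨_, hmem y⟩
  exact ⟨⟨L, hL.continuous⟩, fun x => ⟨hmem x, rfl⟩⟩

theorem cut_apply (hA : IsSelfAdjoint A) (hE : IsSpectralIntegral E id A)
    (hs : MeasurableSet s) (hR : s ⊆ Set.Icc (-R) R) (x : H) (hx : E.proj s x ∈ A.domain) :
    cut E A s x = A ⟨E.proj s x, hx⟩ := by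
  have h := exists_cut_apply hA hE hs hR
  rw [cut, dif_pos h]
  exact (h.choose_spec x).2

theorem proj_mul_cut (hA : IsSelfAdjoint A) (hE : IsSpectralIntegral E id A)
    (ht : MeasurableSet t) (hs : MeasurableSet s) (hR : s ⊆ Set.Icc (-R) R) :
    E.proj t * cut E A s = cut E A (t ∩ s) := by
  ext x
  rw [mul_apply_eq_comp, cut_apply hA hE hs hR x (proj_mem_domain hE hs hR x),
    cut_apply hA hE (ht.inter hs) (Set.inter_subset_right.trans hR) x
      (proj_mem_domain hE (ht.inter hs) (Set.inter_subset_right.trans hR) x),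
    ← hE.apply_proj measurable_id hA.dense_domain ht]
  congr 1
  ext
  exact E.proj_proj ht hs x

theorem cut_mul_proj (hA : IsSelfAdjoint A) (hE : IsSpectralIntegral E id A)
    (ht : MeasurableSet t) (hs : MeasurableSet s) (hR : s ⊆ Set.Icc (-R) R) :
    cut E A s * E.proj t = cut E A (s ∩ t) := by
  ext x
  rw [mul_apply_eq_comp, cut_apply hA hE hs hR _ (proj_mem_domain hE hs hR _),
    cut_apply hA hE (hs.inter ht) (Set.inter_subset_left.trans hR) x
      (proj_mem_domain hE (hs.inter ht) (Set.inter_subset_left.trans hR) x)]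
  congr 1
  ext
  exact E.proj_proj hs ht x

theorem cut_union (hA : IsSelfAdjoint A) (hE : IsSpectralIntegral E id A)
    (hs : MeasurableSet s) (ht : MeasurableSet t) (hd : Disjoint s t)
    (hR : s ∪ t ⊆ Set.Icc (-R) R) : cut E A (s ∪ t) = cut E A s + cut E A t := by
  have h := cut_mul_proj hA hE (hs.union ht) (hs.union ht) hR
  rw [Set.inter_self, E.proj_union hs ht hd, mul_add, cut_mul_proj hA hE hs (hs.union ht) hR,
    cut_mul_proj hA hE ht (hs.union ht) hR, Set.inter_eq_right.2 Set.subset_union_left,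
    Set.inter_eq_right.2 Set.subset_union_right] at h
  exact h.symm

theorem cut_symmetric (hA : IsSelfAdjoint A) (hE : IsSpectralIntegral E id A)
    (hs : MeasurableSet s) (hR : s ⊆ Set.Icc (-R) R) (x y : H) :
    inner ℂ (cut E A s x) y = inner ℂ x (cut E A s y) := by
  rw [cut_apply hA hE hs hR _ (proj_mem_domain hE hs hR _),
    cut_apply hA hE hs hR _ (proj_mem_domain hE hs hR _),
    ← apply_proj_proj hA hE hs x, ← apply_proj_proj hA hE hs y, E.inner_proj_left hs,
    ← E.inner_proj_left hs x]
  exact symmetric_of_isSelfAdjoint hA ⟨_, _⟩ ⟨_, _⟩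

theorem inner_cut (hA : IsSelfAdjoint A) (hE : IsSpectralIntegral E id A)
    (hs : MeasurableSet s) (hR : s ⊆ Set.Icc (-R) R) (x : H) :
    inner ℂ x (cut E A s x) = ((∫ r in s, r ∂(E.scalarMeasure x) : ℝ) : ℂ) := by
  rw [cut_apply hA hE hs hR _ (proj_mem_domain hE hs hR _), ← apply_proj_proj hA hE hs x,
    ← E.inner_proj_left hs, ← E.scalarMeasure_proj x hs]
  exact hE.2 ⟨_, proj_mem_domain hE hs hR x⟩

theorem integrableOn_id_scalarMeasure (hs : MeasurableSet s) (hR : s ⊆ Set.Icc (-R) R) (x : H) :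
    IntegrableOn (fun r : ℝ => r) s (E.scalarMeasure x) :=
  Measure.integrableOn_of_bounded (M := R) (measure_ne_top _ _) measurable_id.aestronglyMeasurable
    (ae_restrict_of_forall_mem hs fun _ hr => abs_le.2 (hR hr))

theorem re_inner_cut_le (hA : IsSelfAdjoint A) (hE : IsSpectralIntegral E id A)
    (hs : MeasurableSet s) (hR : s ⊆ Set.Icc (-R) R) {M : ℝ} (hM : ∀ r ∈ s, r ≤ M) (x : H) :
    (inner ℂ x (cut E A s x)).re ≤ M * ‖E.proj s x‖ ^ 2 := by
  rw [inner_cut hA hE hs hR, Complex.ofReal_re, ← E.measureReal_scalarMeasure x hs, mul_comm,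
    ← smul_eq_mul, ← setIntegral_const]
  exact setIntegral_mono_on (integrableOn_id_scalarMeasure hs hR x) (by simp) hs hM

theorem le_re_inner_cut (hA : IsSelfAdjoint A) (hE : IsSpectralIntegral E id A)
    (hs : MeasurableSet s) (hR : s ⊆ Set.Icc (-R) R) {m : ℝ} (hm : ∀ r ∈ s, m ≤ r) (x : H) :
    m * ‖E.proj s x‖ ^ 2 ≤ (inner ℂ x (cut E A s x)).re := by
  rw [inner_cut hA hE hs hR, Complex.ofReal_re, ← E.measureReal_scalarMeasure x hs, mul_comm,
    ← smul_eq_mul, ← setIntegral_const]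
  exact setIntegral_mono_on (by simp) (integrableOn_id_scalarMeasure hs hR x) hs hm

/-- Translated form of the norm bound of `A E(s)`. -/
theorem norm_cut_sub_smul_le (hA : IsSelfAdjoint A) (hE : IsSpectralIntegral E id A)
    (hs : MeasurableSet s) (hR : s ⊆ Set.Icc (-R) R) {z ε : ℝ} (hε : 0 ≤ ε)
    (hz : s ⊆ Set.Icc (z - ε) (z + ε)) : ‖cut E A s - (z : ℂ) • E.proj s‖ ≤ ε := by
  refine norm_le_of_abs_re_inner_le (fun x y => ?_) hε fun x => ?_
  · simp only [sub_apply, FunLike.coe_smul, Pi.smul_apply, inner_sub_left, inner_sub_right,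
      inner_smul_left, inner_smul_right, Complex.conj_ofReal, cut_symmetric hA hE hs hR,
      E.inner_proj_left hs]
  · have h1 := re_inner_cut_le hA hE hs hR (fun r hr => (hz hr).2) x
    have h2 := le_re_inner_cut hA hE hs hR (fun r hr => (hz hr).1) x
    have h3 : ‖E.proj s x‖ ^ 2 ≤ ‖x‖ ^ 2 := by gcongr; exact E.norm_proj_le hs x
    simp only [sub_apply, FunLike.coe_smul, Pi.smul_apply, inner_sub_right, inner_smul_right,
      E.inner_proj_self hs, Complex.sub_re, ← Complex.ofReal_mul, Complex.ofReal_re]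
    rw [abs_le]
    constructor <;> nlinarith

theorem norm_cut_le (hA : IsSelfAdjoint A) (hE : IsSpectralIntegral E id A)
    (hs : MeasurableSet s) (hR0 : 0 ≤ R) (hR : s ⊆ Set.Icc (-R) R) : ‖cut E A s‖ ≤ R := by
  have h := norm_cut_sub_smul_le hA hE hs hR (z := 0) hR0 (by simpa using hR)
  simpa using h

theorem norm_proj_le_one (E : SpectralMeasure H) (hs : MeasurableSet s) : ‖E.proj s‖ ≤ 1 :=
  ContinuousLinearMap.opNorm_le_bound _ zero_le_one fun x => by
    rw [one_mul]; exact E.norm_proj_le hs x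

end Cut

/-! ### Support of the spectral measure and the formula for |A| -/

section Support

open MeasureTheory

variable {H : Type u} [NormedAddCommGroup H] [InnerProductSpace ℂ H] [CompleteSpace H]
  {E : SpectralMeasure H} {A F : H →ₗ.[ℂ] H}

/-- At a real point z the inverse of A - z is symmetric and defined on all of H, hence bounded by
Hellinger–Toeplitz; `g` is its norm. -/
theorem exists_norm_le_of_notMem_spectrum (hA : IsSelfAdjoint A) {z : ℝ}
    (hz : (z : ℂ) ∉ spectrum A) : ∃ g : ℝ, 0 ≤ g ∧ ∀ x : A.domain,
      ‖(x : H)‖ ≤ g * ‖A x - (z : ℂ) • (x : H)‖ := by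
  simp only [spectrum, Set.mem_ofPred_eq, not_not] at hz
  let L : A.domain →ₗ[ℂ] H := A.toFun - (z : ℂ) • A.domain.subtype
  have hL : Function.Bijective L := hz
  let e := LinearEquiv.ofBijective L hL
  let G : H →ₗ[ℂ] H := A.domain.subtype ∘ₗ e.symm.toLinearMap
  have hGL : ∀ x : A.domain, G (A x - (z : ℂ) • (x : H)) = x := by
    intro x
    change ((e.symm (e x) : A.domain) : H) = x
    rw [LinearEquiv.symm_apply_apply]
  have hG : G.IsSymmetric := by
    intro x y
    obtain ⟨x, rfl⟩ := hL.2 x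
    obtain ⟨y, rfl⟩ := hL.2 y
    change inner ℂ (G (A x - (z : ℂ) • (x : H))) (A y - (z : ℂ) • (y : H)) =
      inner ℂ (A x - (z : ℂ) • (x : H)) (G (A y - (z : ℂ) • (y : H)))
    rw [hGL, hGL, inner_sub_left, inner_sub_right, inner_smul_left, inner_smul_right,
      Complex.conj_ofReal, symmetric_of_isSelfAdjoint hA]
  let G' : H →L[ℂ] H := ⟨G, hG.continuous⟩
  refine ⟨‖G'‖, norm_nonneg _, fun x => ?_⟩
  have := G'.le_opNorm (A x - (z : ℂ) • (x : H))
  have e : G' (A x - (z : ℂ) • (x : H)) = x := hGL x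
  rwa [e] at this

/-- On the range of E(z - ε, z + ε), ‖y‖ ≤ g ‖(A - z) y‖ ≤ g ε ‖y‖, which forces y = 0 once g ε < 1.
-/
theorem exists_proj_Ioo_eq_zero (hA : IsSelfAdjoint A) (hE : IsSpectralIntegral E id A) {z : ℝ}
    (hz : (z : ℂ) ∉ spectrum A) : ∃ ε > 0, E.proj (Set.Ioo (z - ε) (z + ε)) = 0 := by
  obtain ⟨g, hg, h⟩ := exists_norm_le_of_notMem_spectrum hA hz
  refine ⟨1 / (2 * (g + 1)), by positivity, ?_⟩
  set ε := 1 / (2 * (g + 1)) with hε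
  have hε0 : 0 < ε := by positivity
  set J := Set.Ioo (z - ε) (z + ε)
  have hJ : MeasurableSet J := measurableSet_Ioo
  have hR : J ⊆ Set.Icc (-(|z| + ε)) (|z| + ε) := fun r hr =>
    ⟨by linarith [hr.1, neg_abs_le z], by linarith [hr.2, le_abs_self z]⟩
  have hn := norm_cut_sub_smul_le hA hE hJ hR hε0.le Set.Ioo_subset_Icc_self
  ext x
  have h1 := h ⟨_, proj_mem_domain hE hJ hR x⟩
  have h2 := ContinuousLinearMap.le_of_opNorm_le _ hn (E.proj J x)
  have h3 : (cut E A J - (z : ℂ) • E.proj J) (E.proj J x)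
      = A ⟨_, proj_mem_domain hE hJ hR x⟩ - (z : ℂ) • E.proj J x := by
    simp only [sub_apply, FunLike.coe_smul, Pi.smul_apply, E.proj_proj_self hJ]
    rw [cut_apply hA hE hJ hR _ (proj_mem_domain hE hJ hR _)]
    simp only [E.proj_proj_self hJ]
  rw [h3] at h2
  have h4 : ‖E.proj J x‖ ≤ g * ε * ‖E.proj J x‖ := by
    refine h1.trans ?_
    rw [mul_assoc]
    gcongr
  have h5 : g * ε < 1 := by
    rw [hε, mul_one_div, div_lt_one (by positivity)]
    linarith
  have h6 : ‖E.proj J x‖ = 0 := by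
    nlinarith [norm_nonneg (E.proj J x)]
  simpa using h6

/-- Every point below c has a null neighbourhood, and a locally null set of reals is null for each
scalar measure. -/
theorem proj_Iio_eq_zero (hA : IsSelfAdjoint A) (hE : IsSpectralIntegral E id A) {c : ℝ}
    (hc : spectrum A ⊆ Complex.ofReal '' Set.Ici c) : E.proj (Set.Iio c) = 0 := by
  ext x
  have hnull : E.scalarMeasure x (Set.Iio c) = 0 := by
    refine measure_null_of_locally_null _ fun z hz => ?_
    have hzs : (z : ℂ) ∉ spectrum A := by
      intro hmem
      obtain ⟨y, hy, hyz⟩ := hc hmem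
      rw [Complex.ofReal_inj] at hyz
      subst hyz
      exact absurd (Set.mem_Iio.1 hz) (not_lt.2 hy)
    obtain ⟨ε, hε, h0⟩ := exists_proj_Ioo_eq_zero hA hE hzs
    refine ⟨_, mem_nhdsWithin_of_mem_nhds (Ioo_mem_nhds (by linarith : z - ε < z)
      (by linarith : z < z + ε)), ?_⟩
    rw [E.scalarMeasure_apply' x measurableSet_Ioo, h0]
    simp
  rw [E.scalarMeasure_apply' x measurableSet_Iio, ENNReal.ofReal_eq_zero] at hnull
  have : ‖E.proj (Set.Iio c) x‖ = 0 := by nlinarith [norm_nonneg (E.proj (Set.Iio c) x)]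
  simpa using this

theorem domain_abs_eq (hE : IsSpectralIntegral E id A)
    (hF : IsSpectralIntegral E (fun x => |x|) F) : F.domain = A.domain := by
  ext x
  rw [hE.1, hF.1]
  simp only [id, ← ofReal_norm, Real.norm_eq_abs, abs_abs]

/-- `|A| = A - 2 A E([-a, 0))` if the spectral measure of `A` lives on `[-a, ∞)`. -/
theorem abs_apply_eq (hA : IsSelfAdjoint A) (hE : IsSpectralIntegral E id A)
    (hF : IsSpectralIntegral E (fun x => |x|) F) {a : ℝ} (ha : 0 ≤ a)
    (h0 : E.proj (Set.Iio (-a)) = 0) {x : H} (hx : x ∈ A.domain) (hx' : x ∈ F.domain) :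
    F ⟨x, hx'⟩ = A ⟨x, hx⟩ - (2 : ℂ) • cut E A (Set.Ico (-a) 0) x := by
  have hle : A.domain ≤ F.domain := (domain_abs_eq hE hF).ge
  set s := Set.Ico (-a) 0 with hs_def
  have hs : MeasurableSet s := measurableSet_Ico
  have hR : s ⊆ Set.Icc (-a) a := fun r hr => ⟨hr.1, by linarith [hr.2]⟩
  let D : A.domain →ₗ[ℂ] H := F.toFun ∘ₗ Submodule.inclusion hle - A.toFun
    + (2 : ℂ) • ((cut E A s).toLinearMap ∘ₗ A.domain.subtype)
  have hDa : ∀ y : A.domain, D y = F ⟨y, hle y.2⟩ - A y + (2 : ℂ) • cut E A s y := fun _ => rfl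
  have hD : ∀ y : A.domain, inner ℂ (y : H) (D y) = 0 := by
    intro y
    have i1 := hF.integrable (by fun_prop) (hle y.2)
    have i2 : Integrable (fun r : ℝ => r) (E.scalarMeasure (y : H)) :=
      hE.integrable measurable_id y.2
    have i3 : Integrable (s.indicator (fun r : ℝ => r)) (E.scalarMeasure (y : H)) :=
      (integrableOn_id_scalarMeasure hs hR (y : H)).integrable_indicator hs
    have hnull : ∀ᵐ r ∂(E.scalarMeasure (y : H)), -a ≤ r := by
      rw [ae_iff]
      have : {r : ℝ | ¬ -a ≤ r} = Set.Iio (-a) := by ext; simp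
      rw [this, E.scalarMeasure_apply' _ measurableSet_Iio, h0]
      simp
    have hI : ∫ r, (|r| - r + 2 * s.indicator (fun r : ℝ => r) r) ∂(E.scalarMeasure (y : H)) = 0 := by
      refine integral_eq_zero_of_ae (hnull.mono fun r hr => ?_)
      simp only [Pi.zero_apply]
      by_cases h : r < 0
      · rw [Set.indicator_of_mem (show r ∈ s from ⟨hr, h⟩), abs_of_neg h]; ring
      · rw [Set.indicator_of_notMem (fun hm => h hm.2), abs_of_nonneg (not_lt.1 h)]; ring
    have e1 : inner ℂ (y : H) (F ⟨y, hle y.2⟩) = _ := hF.2 ⟨y, hle y.2⟩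
    have e2 : inner ℂ (y : H) (A y) = ((∫ r, r ∂(E.scalarMeasure (y : H)) : ℝ) : ℂ) := hE.2 y
    rw [integral_add (f := fun r => |r| - r) (i1.sub i2) (i3.const_mul 2),
      integral_sub (f := fun r => |r|) i1 i2, integral_const_mul, integral_indicator hs] at hI
    rw [hDa, inner_add_right, inner_sub_right, inner_smul_right, e1, e2, inner_cut hA hE hs hR]
    exact_mod_cast hI
  have h := eq_zero_of_dense_of_inner hA.dense_domain fun y =>
    inner_eq_zero_of_inner_self_eq_zero D hD ⟨x, hx⟩ y
  rw [hDa] at h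
  rw [eq_sub_iff_add_eq, ← sub_eq_zero, ← h]
  abel

end Support

/-! ### Upper bound for the modulus of continuity on [-a, ∞) -/

section Upper

open MeasureTheory

theorem norm_apply_le_of_opNorm_le {H : Type*} [NormedAddCommGroup H] [InnerProductSpace ℂ H]
    {T : H →ₗ.[ℂ] H} {δ : ℝ} (hδ : 0 ≤ δ)
    (h : opNorm T ≤ ENNReal.ofReal δ) (x : T.domain) : ‖T x‖ ≤ δ * ‖(x : H)‖ := by
  rcases eq_or_ne (x : H) 0 with hx | hx
  · have : x = 0 := by ext; exact hx
    rw [this, LinearPMap.map_zero]; simp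
  have hp : 0 < ‖(x : H)‖ := norm_pos_iff.2 hx
  set c : ℂ := ((‖(x : H)‖⁻¹ : ℝ) : ℂ)
  have hc : ‖c‖ = ‖(x : H)‖⁻¹ := by
    rw [Complex.norm_real, Real.norm_of_nonneg (by positivity)]
  have h1 : ‖T (c • x)‖ₑ ≤ ENNReal.ofReal δ := by
    refine le_trans ?_ h
    refine le_iSup₂_of_le (c • x) ?_ le_rfl
    rw [Submodule.coe_smul, norm_smul, hc, inv_mul_cancel₀ hp.ne']
  rw [← ofReal_norm, ENNReal.ofReal_le_ofReal_iff hδ, LinearPMap.map_smul, norm_smul, hc,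
    inv_mul_le_iff₀ hp] at h1
  linarith

variable {H : Type u} [NormedAddCommGroup H] [InnerProductSpace ℂ H] [CompleteSpace H]
  {E G : SpectralMeasure H} {A B : H →ₗ.[ℂ] H} {s t : Set ℝ} {R δ : ℝ}

/-- The operator is E(s)(A - B)G(t), which makes sense because G(t) maps into the common domain for
bounded t. -/
theorem norm_cut_mul_proj_sub_le (hA : IsSelfAdjoint A) (hE : IsSpectralIntegral E id A)
    (hB : IsSelfAdjoint B) (hG : IsSpectralIntegral G id B) (hdom : B.domain ≤ A.domain)
    (hδ : 0 ≤ δ) (h : ∀ x (hx : x ∈ A.domain) (hx' : x ∈ B.domain),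
      ‖A ⟨x, hx⟩ - B ⟨x, hx'⟩‖ ≤ δ * ‖x‖)
    (hs : MeasurableSet s) (hsR : s ⊆ Set.Icc (-R) R) (ht : MeasurableSet t)
    (htR : t ⊆ Set.Icc (-R) R) :
    ‖cut E A s * G.proj t - E.proj s * cut G B t‖ ≤ δ := by
  refine ContinuousLinearMap.opNorm_le_bound _ hδ fun x => ?_
  have hy := proj_mem_domain hG ht htR x
  have e : (cut E A s * G.proj t - E.proj s * cut G B t) x
      = E.proj s (A ⟨_, hdom hy⟩ - B ⟨_, hy⟩) := by
    rw [sub_apply, mul_apply_eq_comp, mul_apply_eq_comp,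
      cut_apply hA hE hs hsR _ (proj_mem_domain hE hs hsR _), cut_apply hB hG ht htR _ hy, map_sub,
      ← hE.apply_proj measurable_id hA.dense_domain hs]
  rw [e]
  refine (E.norm_proj_le hs _).trans ((h _ _ _).trans ?_)
  gcongr
  exact G.norm_proj_le ht x

/-- Spectral subspaces of nearby operators for separated sets are almost orthogonal. -/
theorem norm_proj_mul_proj_le (hA : IsSelfAdjoint A) (hE : IsSpectralIntegral E id A)
    (hB : IsSelfAdjoint B) (hG : IsSpectralIntegral G id B) (hdom : B.domain ≤ A.domain)
    (hδ : 0 ≤ δ) (h : ∀ x (hx : x ∈ A.domain) (hx' : x ∈ B.domain),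
      ‖A ⟨x, hx⟩ - B ⟨x, hx'⟩‖ ≤ δ * ‖x‖)
    (hs : MeasurableSet s) (hsR : s ⊆ Set.Icc (-R) R) (ht : MeasurableSet t)
    (htR : t ⊆ Set.Icc (-R) R) {m n : ℝ} (hn : 0 ≤ n) (hsm : ∀ r ∈ s, m ≤ r)
    (htn : ∀ r ∈ t, r ≤ -n) : (m + n) * ‖E.proj s * G.proj t‖ ≤ δ := by
  have hb := norm_cut_mul_proj_sub_le hA hE hB hG hdom hδ h hs hsR ht htR
  -- Adding m and n on the complementary subspaces makes the lower bounds hold on all of H; the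
  -- added terms are killed by Z = E(s)G(t).
  refine (norm_le_of_sylvester (M := cut E A s + (m : ℂ) • E.proj sᶜ)
    (N := -cut G B t + (n : ℂ) • G.proj tᶜ) hn (fun x => ?_) (fun x => ?_) ?_).trans hb
  · have h1 := le_re_inner_cut hA hE hs hsR hsm x
    have h2 := E.norm_proj_sq_add hs hs.compl disjoint_compl_right x
    rw [Set.union_compl_self, E.proj_univ, one_apply_eq_self] at h2
    simp only [add_apply, FunLike.coe_smul, Pi.smul_apply, inner_add_right, inner_smul_right,
      E.inner_proj_self hs.compl, Complex.add_re, ← Complex.ofReal_mul, Complex.ofReal_re]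
    rw [← h2]
    linarith
  · have h1 := re_inner_cut_le hB hG ht htR htn x
    have h2 := G.norm_proj_sq_add ht ht.compl disjoint_compl_right x
    rw [Set.union_compl_self, G.proj_univ, one_apply_eq_self] at h2
    simp only [add_apply, neg_apply, FunLike.coe_smul, Pi.smul_apply, inner_add_right,
      inner_smul_right, inner_neg_right, G.inner_proj_self ht.compl, Complex.add_re, Complex.neg_re,
      ← Complex.ofReal_mul, Complex.ofReal_re]
    rw [← h2]
    linarith
  · have e1 : E.proj sᶜ * E.proj s = 0 := by
      rw [← E.proj_inter _ _ hs.compl hs, Set.compl_inter_self, E.proj_empty]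
    have e2 : G.proj t * G.proj tᶜ = 0 := by
      rw [← G.proj_inter _ _ ht ht.compl, Set.inter_compl_self, G.proj_empty]
    have e3 : cut E A s * E.proj s = cut E A s := by
      rw [cut_mul_proj hA hE hs hs hsR, Set.inter_self]
    have e4 : G.proj t * cut G B t = cut G B t := by
      rw [proj_mul_cut hB hG ht ht htR, Set.inter_self]
    rw [add_mul, mul_add, mul_neg, smul_mul_assoc, mul_smul_comm, ← mul_assoc, ← mul_assoc, e1, e3,
      mul_assoc _ _ (G.proj tᶜ), e2, mul_assoc, e4]
    simp [sub_eq_add_neg]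

/-- The triangular truncation over `2 ^ k` dyadic blocks costs a constant times `k`. -/
theorem norm_proj_mul_cut_le (hA : IsSelfAdjoint A) (hE : IsSpectralIntegral E id A)
    (hB : IsSelfAdjoint B) (hG : IsSpectralIntegral G id B) (hdom : B.domain ≤ A.domain)
    (hδ : 0 ≤ δ) (h : ∀ x (hx : x ∈ A.domain) (hx' : x ∈ B.domain),
      ‖A ⟨x, hx⟩ - B ⟨x, hx'⟩‖ ≤ δ * ‖x‖) (k : ℕ) :
    ∀ {c : ℝ} {s t : Set ℝ}, 0 < c → MeasurableSet s → s ⊆ Set.Icc 0 R → MeasurableSet t →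
      t ⊆ Set.Icc (-R) R → t ⊆ Set.Icc (-(c * 2 ^ 2 ^ k)) (-c) →
      ‖E.proj s * cut G B t‖ ≤ (2 + 3 * k) * δ := by
  have hIcc : ∀ {s : Set ℝ}, s ⊆ Set.Icc 0 R → s ⊆ Set.Icc (-R) R := fun hs r hr =>
    ⟨by linarith [(hs hr).1, (hs hr).2], (hs hr).2⟩
  induction k with
  | zero =>
    intro c s t hc hs hsR ht htR htc
    have h1 := norm_proj_mul_proj_le hA hE hB hG hdom hδ h hs (hIcc hsR) ht htR hc.le
      (fun r hr => (hsR hr).1) (fun r hr => (htc hr).2)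
    have h2 : ‖cut G B t‖ ≤ c * 2 := norm_cut_le hB hG ht (by positivity) fun r hr =>
      ⟨by simpa using (htc hr).1, by linarith [(htc hr).2]⟩
    have e : E.proj s * cut G B t = E.proj s * G.proj t * cut G B t := by
      rw [mul_assoc, proj_mul_cut hB hG ht ht htR, Set.inter_self]
    rw [e]
    -- On a block of ratio 2, ‖E(s)G(t)‖ ≤ δ/c and B has norm at most 2c, so nothing has to be
    -- split.
    calc _ ≤ ‖E.proj s * G.proj t‖ * (c * 2) := (norm_mul_le _ _).trans (by gcongr)
      _ = 2 * ((0 + c) * ‖E.proj s * G.proj t‖) := by ring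
      _ ≤ 2 * δ := by gcongr
      _ = _ := by simp
  | succ k ih =>
    intro c s t hc hs hsR ht htR htc
    -- The geometric mean of the endpoints c and c · 2^(2^(k+1)): each half again has ratio 2^(2^k).
    set d := c * 2 ^ 2 ^ k with hd
    have hd0 : 0 < d := by positivity
    have hcd : c * 2 ^ 2 ^ (k + 1) = d * 2 ^ 2 ^ k := by
      rw [hd, pow_succ 2 k, pow_mul, pow_two]; ring
    rw [hcd] at htc
    have ms₁ : MeasurableSet (s ∩ Set.Iio d) := hs.inter measurableSet_Iio
    have ms₂ : MeasurableSet (s ∩ Set.Ici d) := hs.inter measurableSet_Ici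
    have mt₁ : MeasurableSet (t ∩ Set.Ioi (-d)) := ht.inter measurableSet_Ioi
    have mt₂ : MeasurableSet (t ∩ Set.Iic (-d)) := ht.inter measurableSet_Iic
    have us : s ∩ Set.Iio d ∪ s ∩ Set.Ici d = s := by
      rw [← Set.inter_union_distrib_left, Set.Iio_union_Ici, Set.inter_univ]
    have ut : t ∩ Set.Ioi (-d) ∪ t ∩ Set.Iic (-d) = t := by
      rw [← Set.inter_union_distrib_left, Set.union_comm, Set.Iic_union_Ioi, Set.inter_univ]
    have ds : Disjoint (s ∩ Set.Iio d) (s ∩ Set.Ici d) :=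
      Set.disjoint_left.2 fun r hr hr' => absurd (Set.mem_Iio.1 hr.2) (not_lt.2 hr'.2)
    have dt : Disjoint (t ∩ Set.Ioi (-d)) (t ∩ Set.Iic (-d)) :=
      Set.disjoint_left.2 fun r hr hr' => absurd (Set.mem_Ioi.1 hr.2) (not_lt.2 hr'.2)
    have ps := E.proj_union ms₁ ms₂ ds
    have pt := cut_union hB hG mt₁ mt₂ dt (ut.trans_subset htR)
    have ss₁ : s ∩ Set.Iio d ⊆ s := Set.inter_subset_left
    have ss₂ : s ∩ Set.Ici d ⊆ s := Set.inter_subset_left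
    have st₁ : t ∩ Set.Ioi (-d) ⊆ t := Set.inter_subset_left
    have st₂ : t ∩ Set.Iic (-d) ⊆ t := Set.inter_subset_left
    have ls₁ : ∀ r ∈ s ∩ Set.Iio d, r ≤ d := fun r hr => (Set.mem_Iio.1 hr.2).le
    have ls₂ : ∀ r ∈ s ∩ Set.Ici d, d ≤ r := fun r hr => hr.2
    have lt₁ : ∀ r ∈ t ∩ Set.Ioi (-d), -d ≤ r := fun r hr => (Set.mem_Ioi.1 hr.2).le
    have lt₂ : ∀ r ∈ t ∩ Set.Iic (-d), r ≤ -d := fun r hr => hr.2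
    rw [us] at ps
    rw [ut] at pt
    generalize s ∩ Set.Iio d = s₁ at *
    generalize s ∩ Set.Ici d = s₂ at *
    generalize t ∩ Set.Ioi (-d) = t₁ at *
    generalize t ∩ Set.Iic (-d) = t₂ at *
    have diag : ‖E.proj s₁ * cut G B t₁ + E.proj s₂ * cut G B t₂‖ ≤ (2 + 3 * k) * δ := by
      refine norm_add_le_of_orthogonal (q₁ := G.proj t₁) (q₂ := G.proj t₂) (by positivity)
        (fun x y => E.inner_proj_proj_of_disjoint ms₁ ms₂ ds _ _) ?_ ?_ (fun x => ?_) ?_ ?_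
      · rw [mul_assoc, cut_mul_proj hB hG mt₁ mt₁ (st₁.trans htR), Set.inter_self]
      · rw [mul_assoc, cut_mul_proj hB hG mt₂ mt₂ (st₂.trans htR), Set.inter_self]
      · rw [G.norm_proj_sq_add mt₁ mt₂ dt, ut]
        gcongr
        exact G.norm_proj_le ht x
      · exact ih hc ms₁ (ss₁.trans hsR) mt₁ (st₁.trans htR)
          fun r hr => ⟨lt₁ r hr, (htc (st₁ hr)).2.trans (by simp)⟩
      · exact ih hd0 ms₂ (ss₂.trans hsR) mt₂ (st₂.trans htR)
          fun r hr => ⟨(htc (st₂ hr)).1, lt₂ r hr⟩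
    -- Here B is at most d in norm on `t₁`, while `s₂` lies at distance at least d from `t₁`.
    have off₁ : ‖E.proj s₂ * cut G B t₁‖ ≤ δ := by
      have h1 := norm_proj_mul_proj_le hA hE hB hG hdom hδ h ms₂ (hIcc (ss₂.trans hsR)) mt₁
        (st₁.trans htR) le_rfl ls₂ (fun r hr => by linarith [(htc (st₁ hr)).2])
      have h2 : ‖cut G B t₁‖ ≤ d := norm_cut_le hB hG mt₁ hd0.le fun r hr =>
        ⟨lt₁ r hr, by linarith [(htc (st₁ hr)).2]⟩
      have e : E.proj s₂ * cut G B t₁ = E.proj s₂ * G.proj t₁ * cut G B t₁ := by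
        rw [mul_assoc, proj_mul_cut hB hG mt₁ mt₁ (st₁.trans htR), Set.inter_self]
      rw [e]
      calc _ ≤ ‖E.proj s₂ * G.proj t₁‖ * d := (norm_mul_le _ _).trans (by gcongr)
        _ = (d + 0) * ‖E.proj s₂ * G.proj t₁‖ := by ring
        _ ≤ δ := h1
    -- B may be large on `t₂`, so it is traded for A, which is at most d in norm on `s₁`, at the
    -- price of one further δ.
    have off₂ : ‖E.proj s₁ * cut G B t₂‖ ≤ 2 * δ := by
      have h1 := norm_proj_mul_proj_le hA hE hB hG hdom hδ h ms₁ (hIcc (ss₁.trans hsR)) mt₂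
        (st₂.trans htR) hd0.le (fun r hr => (hsR (ss₁ hr)).1) lt₂
      have h2 : ‖cut E A s₁‖ ≤ d := norm_cut_le hA hE ms₁ hd0.le fun r hr =>
        ⟨by linarith [(hsR (ss₁ hr)).1], ls₁ r hr⟩
      have h3 := norm_cut_mul_proj_sub_le hA hE hB hG hdom hδ h ms₁ (hIcc (ss₁.trans hsR)) mt₂
        (st₂.trans htR)
      have e : cut E A s₁ * (E.proj s₁ * G.proj t₂) = cut E A s₁ * G.proj t₂ := by
        rw [← mul_assoc, cut_mul_proj hA hE ms₁ ms₁ (hIcc (ss₁.trans hsR)), Set.inter_self]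
      have h4 : ‖cut E A s₁ * G.proj t₂‖ ≤ δ := by
        rw [← e]
        calc _ ≤ d * ‖E.proj s₁ * G.proj t₂‖ := (norm_mul_le _ _).trans (by gcongr)
          _ = (0 + d) * ‖E.proj s₁ * G.proj t₂‖ := by ring
          _ ≤ δ := h1
      calc _ = ‖cut E A s₁ * G.proj t₂ - (cut E A s₁ * G.proj t₂ - E.proj s₁ * cut G B t₂)‖ := by
            congr 1; abel
        _ ≤ δ + δ := (norm_sub_le _ _).trans (add_le_add h4 h3)
        _ = _ := by ring
    have e : E.proj s * cut G B t = E.proj s₁ * cut G B t₁ + E.proj s₂ * cut G B t₂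
        + E.proj s₂ * cut G B t₁ + E.proj s₁ * cut G B t₂ := by
      rw [ps, pt]; noncomm_ring
    rw [e]
    calc _ ≤ (2 + 3 * k) * δ + δ + 2 * δ :=
          (norm_add_le _ _).trans (add_le_add ((norm_add_le _ _).trans (add_le_add diag off₁)) off₂)
      _ = _ := by push_cast; ring

/-- The piece of B on (-δ, 0) costs δ trivially and the rest is covered by `norm_proj_mul_cut_le`
with c = δ. The half-line [0, ∞) is reached as a strong limit of [0, n), since that estimate needs
bounded sets. -/
theorem norm_proj_Ici_mul_cut_le (hA : IsSelfAdjoint A) (hE : IsSpectralIntegral E id A)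
    (hB : IsSelfAdjoint B) (hG : IsSpectralIntegral G id B) (hdom : B.domain ≤ A.domain)
    (hδ : 0 < δ) (h : ∀ x (hx : x ∈ A.domain) (hx' : x ∈ B.domain),
      ‖A ⟨x, hx⟩ - B ⟨x, hx'⟩‖ ≤ δ * ‖x‖) {k : ℕ} {a : ℝ} (ha : 0 ≤ a) (hk : a ≤ δ * 2 ^ 2 ^ k) :
    ‖E.proj (Set.Ici 0) * cut G B (Set.Ico (-a) 0)‖ ≤ (3 + 3 * k) * δ := by
  set t := Set.Ico (-a) 0
  have ht : MeasurableSet t := measurableSet_Ico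
  have hta : t ⊆ Set.Icc (-a) a := fun r hr => ⟨hr.1, by linarith [hr.2]⟩
  have fin : ∀ n : ℕ, ‖E.proj (Set.Ico 0 (n : ℝ)) * cut G B t‖ ≤ (3 + 3 * k) * δ := by
    intro n
    have hn : Set.Ico (0 : ℝ) n ⊆ Set.Icc 0 (max n a) := fun r hr =>
      ⟨hr.1, hr.2.le.trans (le_max_left _ _)⟩
    have htR : t ⊆ Set.Icc (-(max (n : ℝ) a)) (max n a) := fun r hr =>
      ⟨by linarith [(hta hr).1, le_max_right (n : ℝ) a], (hta hr).2.trans (le_max_right _ _)⟩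
    have ut : t ∩ Set.Iic (-δ) ∪ t ∩ Set.Ioi (-δ) = t := by
      rw [← Set.inter_union_distrib_left, Set.Iic_union_Ioi, Set.inter_univ]
    have mt₁ : MeasurableSet (t ∩ Set.Iic (-δ)) := ht.inter measurableSet_Iic
    have mt₂ : MeasurableSet (t ∩ Set.Ioi (-δ)) := ht.inter measurableSet_Ioi
    have dt : Disjoint (t ∩ Set.Iic (-δ)) (t ∩ Set.Ioi (-δ)) :=
      Set.disjoint_left.2 fun r hr hr' => absurd (Set.mem_Ioi.1 hr'.2) (not_lt.2 hr.2)
    have h1 := norm_proj_mul_cut_le hA hE hB hG hdom hδ.le h k hδ measurableSet_Ico hn mt₁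
      (Set.inter_subset_left.trans htR)
      (fun r hr => ⟨by linarith [(hta hr.1).1], hr.2⟩)
    have h2 : ‖cut G B (t ∩ Set.Ioi (-δ))‖ ≤ δ := norm_cut_le hB hG mt₂ hδ.le fun r hr =>
      ⟨(Set.mem_Ioi.1 hr.2).le, by linarith [hr.1.2]⟩
    have h3 : ‖E.proj (Set.Ico 0 (n : ℝ)) * cut G B (t ∩ Set.Ioi (-δ))‖ ≤ 1 * δ :=
      (norm_mul_le _ _).trans (mul_le_mul (norm_proj_le_one E measurableSet_Ico) h2
        (norm_nonneg _) zero_le_one)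
    have pt := cut_union hB hG mt₁ mt₂ dt (ut.trans_subset hta)
    rw [ut] at pt
    rw [pt, mul_add]
    calc _ ≤ (2 + 3 * k) * δ + 1 * δ := (norm_add_le _ _).trans (add_le_add h1 h3)
      _ = _ := by ring
  refine ContinuousLinearMap.opNorm_le_bound _ (by positivity) fun x => ?_
  refine le_of_tendsto (E.tendsto_proj_Ico (cut G B t x)).norm (Filter.Eventually.of_forall fun n => ?_)
  exact ContinuousLinearMap.le_of_opNorm_le _ (fin n) x

theorem norm_cut_sub_cut_le (hA : IsSelfAdjoint A) (hE : IsSpectralIntegral E id A)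
    (hB : IsSelfAdjoint B) (hG : IsSpectralIntegral G id B) (hdom : A.domain = B.domain)
    (hδ : 0 < δ) (h : ∀ x (hx : x ∈ A.domain) (hx' : x ∈ B.domain),
      ‖A ⟨x, hx⟩ - B ⟨x, hx'⟩‖ ≤ δ * ‖x‖) {k : ℕ} {a : ℝ} (ha : 0 ≤ a) (hk : a ≤ δ * 2 ^ 2 ^ k)
    (hE0 : E.proj (Set.Iio (-a)) = 0) (hG0 : G.proj (Set.Iio (-a)) = 0) :
    ‖cut E A (Set.Ico (-a) 0) - cut G B (Set.Ico (-a) 0)‖ ≤ (7 + 6 * k) * δ := by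
  have h1 := norm_proj_Ici_mul_cut_le hA hE hB hG hdom.ge hδ h ha hk
  have h2 := norm_proj_Ici_mul_cut_le hB hG hA hE hdom.le hδ
    (fun x hx hx' => by rw [norm_sub_rev]; exact h x hx' hx) ha hk
  set t := Set.Ico (-a) 0
  have ht : MeasurableSet t := measurableSet_Ico
  have hta : t ⊆ Set.Icc (-a) a := fun r hr => ⟨hr.1, by linarith [hr.2]⟩
  have h3 := norm_cut_mul_proj_sub_le hA hE hB hG hdom.ge hδ.le h ht hta ht hta
  have compl : ∀ F : SpectralMeasure H, F.proj (Set.Iio (-a)) = 0 →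
      F.proj (Set.Ici 0) = 1 - F.proj t := by
    intro F hF
    have e := F.proj_compl (s := Set.Iio 0) measurableSet_Iio
    rw [Set.compl_Iio, ← Set.Iio_union_Ico_eq_Iio (neg_nonpos.2 ha),
      F.proj_union measurableSet_Iio measurableSet_Ico, hF, zero_add] at e
    · exact e
    · exact Set.disjoint_left.2 fun r hr hr' => absurd (Set.mem_Iio.1 hr) (not_lt.2 hr'.1)
  -- This is the adjoint of the term estimated in `h2`, with A and B exchanged.
  have h4 : ‖cut E A t * G.proj (Set.Ici 0)‖ ≤ (3 + 3 * k) * δ := by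
    have hst : IsSelfAdjoint (cut E A t) :=
      ContinuousLinearMap.isSelfAdjoint_iff_isSymmetric.2 fun x y =>
        cut_symmetric hA hE ht hta x y
    rw [← norm_star, star_mul, (G.isStarProjection _ measurableSet_Ici).isSelfAdjoint.star_eq,
      hst.star_eq]
    exact h2
  have e1 : E.proj t * cut E A t = cut E A t := by
    rw [proj_mul_cut hA hE ht ht hta, Set.inter_self]
  have e2 : cut G B t * G.proj t = cut G B t := by
    rw [cut_mul_proj hB hG ht ht hta, Set.inter_self]
  -- Nothing lies below -a, so E([0, ∞)) = 1 - E(t), and likewise for G.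
  have e : cut E A t - cut G B t = cut E A t * G.proj t - E.proj t * cut G B t
      + cut E A t * G.proj (Set.Ici 0) - E.proj (Set.Ici 0) * cut G B t := by
    rw [compl E hE0, compl G hG0]; noncomm_ring
  rw [e]
  calc _ ≤ δ + (3 + 3 * k) * δ + (3 + 3 * k) * δ :=
        (norm_sub_le _ _).trans (add_le_add ((norm_add_le _ _).trans (add_le_add h3 h4)) h1)
    _ = _ := by ring

/-- The depth k is about log₂ log₂ x. The expression 15 + 12k is the total cost 1 + 2(7 + 6k) in
`operatorModulus_abs_Ici_le`. -/
theorem exists_two_pow_two_pow {x : ℝ} :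
    ∃ k : ℕ, x ≤ 2 ^ 2 ^ k ∧ 15 + 12 * (k : ℝ) ≤ 81 * Real.log (2 + Real.posLog x) := by
  set y := 2 + Real.posLog x with hy
  have hp : 0 ≤ Real.posLog x := Real.posLog_nonneg
  have hl2 : 0.6931471803 < Real.log 2 := Real.log_two_gt_d9
  have hly : Real.log 2 ≤ Real.log y := Real.log_le_log (by norm_num) (by linarith)
  -- The extra 1 doubles the exponent, which absorbs the factor log 2 because 2 log 2 > 1. The
  -- constant is 81 = 24 + 57: 15 + 12k ≤ 39 + 24 log y, and 39 ≤ 57 log 2 ≤ 57 log y.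
  refine ⟨⌈Real.log y / Real.log 2⌉₊ + 1, ?_, ?_⟩
  · set k := ⌈Real.log y / Real.log 2⌉₊
    have h1 : Real.log y ≤ k * Real.log 2 := by
      rw [← div_le_iff₀ (by linarith)]; exact Nat.le_ceil _
    have h2 : y ≤ 2 ^ k := by
      rw [← Real.log_le_log_iff (by linarith) (by positivity), Real.log_pow]; exact h1
    rcases le_or_gt x 1 with hx | hx
    · exact hx.trans (one_le_pow₀ (by norm_num))
    · rw [← Real.log_le_log_iff (by linarith) (by positivity), Real.log_pow]
      have h3 : Real.log x ≤ Real.posLog x := le_max_right _ _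
      have h4 : (0 : ℝ) < 2 ^ k := by positivity
      rw [pow_succ]
      push_cast
      nlinarith
  · have h1 := Nat.ceil_lt_add_one (a := Real.log y / Real.log 2)
      (div_nonneg (by linarith) (by linarith))
    have h2 : Real.log y / Real.log 2 ≤ 2 * Real.log y := by
      rw [div_le_iff₀ (by linarith)]; nlinarith
    push_cast
    nlinarith

theorem operatorModulus_abs_Ici_le {a δ : ℝ} (ha : 0 < a) (hδ : 0 < δ) :
    operatorModulus.{u} (fun x => |x|) (Set.Ici (-a)) δ ≤
      ENNReal.ofReal (81 * δ * Real.log (2 + Real.posLog (a / δ))) := by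
  refine sSup_le ?_
  rintro r ⟨H, _, _, _, A, B, fA, fB, hA, hB, sA, sB, hdom, hAB, ⟨E, hE, hEf⟩, ⟨G, hG, hGf⟩, rfl⟩
  have h : ∀ x (hx : x ∈ A.domain) (hx' : x ∈ B.domain),
      ‖A ⟨x, hx⟩ - B ⟨x, hx'⟩‖ ≤ δ * ‖x‖ := fun x hx hx' =>
    norm_apply_le_of_opNorm_le hδ.le hAB ⟨x, hx, hx'⟩
  obtain ⟨k, hk, hkC⟩ := exists_two_pow_two_pow (x := a / δ)
  rw [div_le_iff₀ hδ, mul_comm] at hk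
  have hE0 := proj_Iio_eq_zero hA hE sA
  have hG0 := proj_Iio_eq_zero hB hG sB
  have hc := norm_cut_sub_cut_le hA hE hB hG hdom hδ h ha.le hk hE0 hG0
  refine iSup₂_le fun x hx => ?_
  rw [← ofReal_norm]
  refine ENNReal.ofReal_le_ofReal ?_
  have mA : (x : H) ∈ A.domain := (domain_abs_eq hE hEf).le x.2.1
  have mB : (x : H) ∈ B.domain := (domain_abs_eq hG hGf).le x.2.2
  have e : (fA - fB) x = (A ⟨x, mA⟩ - B ⟨x, mB⟩)
      - (2 : ℂ) • (cut E A (Set.Ico (-a) 0) - cut G B (Set.Ico (-a) 0)) (x : H) := by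
    change fA ⟨x, x.2.1⟩ - fB ⟨x, x.2.2⟩ = _
    rw [abs_apply_eq hA hE hEf ha.le hE0 mA, abs_apply_eq hB hG hGf ha.le hG0 mB, sub_apply,
      smul_sub]
    abel
  rw [e]
  have h1 := h x mA mB
  have h2 := ContinuousLinearMap.le_of_opNorm_le _ hc (x : H)
  calc _ ≤ δ * ‖(x : H)‖ + 2 * ((7 + 6 * k) * δ * ‖(x : H)‖) := by
        refine (norm_sub_le _ _).trans (add_le_add h1 ?_)
        rw [norm_smul]
        simpa using h2
    _ = (15 + 12 * k) * (δ * ‖(x : H)‖) := by ring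
    _ ≤ 81 * Real.log (2 + Real.posLog (a / δ)) * (δ * 1) :=
        mul_le_mul hkC (by gcongr) (by positivity) (le_trans (by positivity) hkC)
    _ = _ := by ring

end Upper

/-! ### Diagonal operators and their explicit spectral measures -/

section Diagonal

open MeasureTheory InnerProductSpace

variable {H : Type u} [NormedAddCommGroup H] [InnerProductSpace ℂ H]
  {ι κ : Type*} [Fintype ι] [Fintype κ] (b : OrthonormalBasis ι ℂ H) (d : OrthonormalBasis κ ℂ H)

/-- The operator that is diagonal in an orthonormal basis. -/
def diagOp (c : ι → ℂ) : H →L[ℂ] H := ∑ i, c i • rankOne ℂ (b i) (b i)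

theorem diagOp_apply (c : ι → ℂ) (x : H) :
    diagOp b c x = ∑ i, c i • (inner ℂ (b i) x • b i) := by
  simp [diagOp]

theorem inner_diagOp (c : ι → ℂ) (i : ι) (x : H) :
    inner ℂ (b i) (diagOp b c x) = c i * inner ℂ (b i) x := by
  classical
  rw [diagOp_apply, inner_sum]
  simp [inner_smul_right, orthonormal_iff_ite.1 b.orthonormal]

theorem ext_inner_orthonormalBasis {x y : H} (h : ∀ i, inner ℂ (b i) x = inner ℂ (b i) y) :
    x = y := by
  apply b.repr.injective
  ext i
  simpa [b.repr_apply_apply] using h i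

theorem diagOp_one : diagOp b (fun _ => 1) = 1 := by
  ext x
  exact ext_inner_orthonormalBasis b fun i => by rw [inner_diagOp]; simp

theorem diagOp_mul (c e : ι → ℂ) : diagOp b c * diagOp b e = diagOp b (fun i => c i * e i) := by
  ext x
  refine ext_inner_orthonormalBasis b fun i => ?_
  rw [mul_apply_eq_comp, inner_diagOp, inner_diagOp, inner_diagOp, mul_assoc]

theorem diagOp_sub (c e : ι → ℂ) : diagOp b c - diagOp b e = diagOp b (fun i => c i - e i) := by
  ext x
  refine ext_inner_orthonormalBasis b fun i => ?_
  rw [sub_apply, inner_sub_right, inner_diagOp, inner_diagOp, inner_diagOp, sub_mul]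

theorem inner_diagOp_left (c : ι → ℂ) (x y : H) :
    inner ℂ (diagOp b c x) y = inner ℂ x (diagOp b (fun i => (starRingEnd ℂ) (c i)) y) := by
  rw [diagOp_apply, diagOp_apply, sum_inner, inner_sum]
  refine Finset.sum_congr rfl fun i _ => ?_
  simp only [inner_smul_left, inner_smul_right, inner_conj_symm]
  ring

theorem norm_diagOp_apply_sq (c : ι → ℂ) (x : H) :
    ‖diagOp b c x‖ ^ 2 = ∑ i, ‖c i‖ ^ 2 * ‖inner ℂ (b i) x‖ ^ 2 := by
  rw [← b.sum_sq_norm_inner_right]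
  simp_rw [inner_diagOp, norm_mul, mul_pow]

theorem norm_diagOp_le {c : ι → ℂ} {R : ℝ} (hR : 0 ≤ R) (h : ∀ i, ‖c i‖ ≤ R) :
    ‖diagOp b c‖ ≤ R := by
  refine ContinuousLinearMap.opNorm_le_bound _ hR fun x => ?_
  refine le_of_sq_le_sq ?_ (by positivity)
  rw [norm_diagOp_apply_sq, mul_pow, ← b.sum_sq_norm_inner_right x, Finset.mul_sum]
  refine Finset.sum_le_sum fun i _ => ?_
  gcongr
  exact h i

theorem isSelfAdjoint_diagOp [CompleteSpace H] (v : ι → ℝ) :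
    IsSelfAdjoint (diagOp b fun i => (v i : ℂ)) :=
  ContinuousLinearMap.isSelfAdjoint_iff_isSymmetric.2 fun x y => by
    simpa using inner_diagOp_left b (fun i => (v i : ℂ)) x y

theorem hasSum_indicator_one_iUnion {s : ℕ → Set ℝ} (hd : Pairwise (Function.onFun Disjoint s))
    (r : ℝ) : HasSum (fun n => (s n).indicator (fun _ => (1 : ℂ)) r)
      ((⋃ n, s n).indicator (fun _ => 1) r) := by
  by_cases h : r ∈ ⋃ n, s n
  · obtain ⟨n, hn⟩ := Set.mem_iUnion.1 h
    rw [Set.indicator_of_mem h]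
    convert hasSum_single (f := fun n => (s n).indicator (fun _ => (1 : ℂ)) r) n fun m hm => ?_
    · rw [Set.indicator_of_mem hn]
    · exact Set.indicator_of_notMem (Set.disjoint_left.1 (hd hm.symm) hn) _
  · rw [Set.indicator_of_notMem h]
    convert hasSum_zero with n
    exact Set.indicator_of_notMem (fun hn => h (Set.mem_iUnion.2 ⟨n, hn⟩)) _

/-- A bounded operator as a partially defined one. -/
abbrev toPMapTop (T : H →L[ℂ] H) : H →ₗ.[ℂ] H := (T : H →ₗ[ℂ] H).toPMap ⊤

theorem opNorm_toPMapTop_sub (S T : H →L[ℂ] H) :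
    opNorm (toPMapTop S - toPMapTop T) = ENNReal.ofReal ‖S - T‖ := by
  refine le_antisymm (iSup₂_le fun x hx => ?_) ?_
  · rw [← ofReal_norm]
    refine ENNReal.ofReal_le_ofReal ?_
    exact ((S - T).le_opNorm (x : H)).trans (mul_le_of_le_one_right (norm_nonneg _) hx)
  · rw [ofReal_norm, enorm_eq_nnnorm]
    refine ENNReal.le_of_forall_nnreal_lt fun r hr => ?_
    obtain ⟨x, hx, hxr⟩ := (S - T).exists_lt_apply_of_lt_opNNNorm (ENNReal.coe_lt_coe.1 hr)
    refine le_iSup₂_of_le ⟨x, trivial, trivial⟩ hx.le ?_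
    change (r : ℝ≥0∞) ≤ ‖(S - T) x‖ₑ
    rw [enorm_eq_nnnorm]
    exact_mod_cast hxr.le

theorem spectrum_diagOp_subset (v : ι → ℝ) {F : Set ℝ} (hv : ∀ i, v i ∈ F) :
    spectrum (toPMapTop (diagOp b fun i => (v i : ℂ))) ⊆ Complex.ofReal '' F := by
  intro z hz
  by_contra hF
  have hne : ∀ i, (v i : ℂ) - z ≠ 0 := fun i h0 => hF ⟨v i, hv i, by rw [← sub_eq_zero, h0]⟩
  have e : ∀ x : H, diagOp b (fun i => (v i : ℂ)) x - z • x = diagOp b (fun i => (v i : ℂ) - z) x := by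
    intro x
    refine ext_inner_orthonormalBasis b fun i => ?_
    rw [inner_sub_right, inner_diagOp, inner_diagOp, inner_smul_right, sub_mul]
  refine hz ⟨fun x y hxy => ?_, fun y => ⟨⟨diagOp b (fun i => ((v i : ℂ) - z)⁻¹) y, trivial⟩, ?_⟩⟩
  · change diagOp b _ (x : H) - z • (x : H) = diagOp b _ (y : H) - z • (y : H) at hxy
    rw [e, e] at hxy
    ext
    refine ext_inner_orthonormalBasis b fun i => ?_
    have h := congrArg (inner ℂ (b i)) hxy
    rw [inner_diagOp, inner_diagOp] at h
    exact mul_left_cancel₀ (hne i) h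
  · change diagOp b _ (diagOp b _ y) - z • (diagOp b _ y) = y
    rw [e]
    refine ext_inner_orthonormalBasis b fun i => ?_
    rw [inner_diagOp, inner_diagOp, mul_inv_cancel_left₀ (hne i)]

variable [CompleteSpace H]

/-- The spectral measure of a diagonal operator. -/
def diagSpectralMeasure (v : ι → ℝ) : SpectralMeasure H where
  proj s := diagOp b fun i => s.indicator (fun _ => 1) (v i)
  isStarProjection s _ := by
    refine ⟨?_, ?_⟩
    · rw [IsIdempotentElem, diagOp_mul]
      congr 1
      ext i
      by_cases h : v i ∈ s <;> simp [h]
    · convert isSelfAdjoint_diagOp b (fun i => s.indicator (fun _ => 1) (v i)) with i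
      by_cases h : v i ∈ s <;> simp [h]
  proj_univ := by simpa using diagOp_one b
  proj_inter s t _ _ := by
    rw [diagOp_mul]
    congr 1
    ext i
    by_cases h : v i ∈ s <;> by_cases h' : v i ∈ t <;> simp [h, h']
  hasSum_proj_iUnion s _ hd x := by
    simp_rw [diagOp_apply]
    exact hasSum_sum fun i _ => (hasSum_indicator_one_iUnion hd (v i)).smul_const _

theorem scalarMeasure_diagSpectralMeasure (v : ι → ℝ) (x : H) :
    (diagSpectralMeasure b v).scalarMeasure x =
      ∑ i, ENNReal.ofReal (‖inner ℂ (b i) x‖ ^ 2) • Measure.dirac (v i) := by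
  ext s hs
  rw [SpectralMeasure.scalarMeasure_apply' _ _ hs, Measure.finsetSum_apply]
  change ENNReal.ofReal (‖diagOp b _ x‖ ^ 2) = _
  rw [norm_diagOp_apply_sq, ENNReal.ofReal_sum_of_nonneg (fun _ _ => by positivity)]
  refine Finset.sum_congr rfl fun i _ => ?_
  rw [Measure.smul_apply, Measure.dirac_apply' _ hs]
  by_cases h : v i ∈ s <;> simp [h]

theorem isSpectralIntegral_diagOp (v : ι → ℝ) {f : ℝ → ℝ} (hf : Measurable f) :
    IsSpectralIntegral (diagSpectralMeasure b v) f
      (toPMapTop (diagOp b fun i => (f (v i) : ℂ))) := by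
  refine ⟨fun x => ?_, fun x => ?_⟩
  · rw [scalarMeasure_diagSpectralMeasure, lintegral_finsetSum_measure]
    simp only [LinearMap.toPMap_domain, Submodule.mem_top, true_iff, lintegral_smul_measure]
    refine ENNReal.sum_lt_top.2 fun i _ => ?_
    rw [lintegral_dirac' _ (by fun_prop)]
    exact ENNReal.mul_lt_top (by simp) (by simp)
  · rw [scalarMeasure_diagSpectralMeasure, integral_finsetSum_measure]
    · change inner ℂ (x : H) (diagOp b _ (x : H)) = _
      rw [diagOp_apply, inner_sum, Complex.ofReal_sum]
      refine Finset.sum_congr rfl fun i _ => ?_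
      rw [integral_smul_measure, integral_dirac, ENNReal.toReal_ofReal (by positivity),
        inner_smul_right, inner_smul_right, ← inner_conj_symm (x : H), Complex.mul_conj',
        smul_eq_mul, Complex.ofReal_mul, Complex.ofReal_pow, mul_comm]
    · intro i _
      exact (integrable_dirac (by simp)).smul_measure (by simp)

theorem toPMapTop_isSelfAdjoint {T : H →L[ℂ] H} (hT : IsSelfAdjoint T) :
    IsSelfAdjoint (toPMapTop T) := by
  rw [LinearPMap.isSelfAdjoint_def, ContinuousLinearMap.toPMap_adjoint_eq_adjoint_toPMap_of_dense,
    ← ContinuousLinearMap.star_eq_adjoint, hT.star_eq]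
  simp

/-- Diagonal pairs are admissible competitors in the supremum. This serves the lower bound and also
transfers the upper bound to finite-dimensional operators. -/
theorem ofReal_norm_sub_le_operatorModulus {f : ℝ → ℝ} (hf : Measurable f) {F : Set ℝ} {δ : ℝ}
    {v : ι → ℝ} {w : κ → ℝ} (hv : ∀ i, v i ∈ F) (hw : ∀ i, w i ∈ F)
    (h : ‖diagOp b (fun i => (v i : ℂ)) - diagOp d (fun i => (w i : ℂ))‖ ≤ δ) :
    ENNReal.ofReal ‖diagOp b (fun i => (f (v i) : ℂ)) - diagOp d (fun i => (f (w i) : ℂ))‖ ≤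
      operatorModulus.{u} f F δ := by
  refine le_sSup ⟨H, inferInstance, inferInstance, inferInstance, toPMapTop (diagOp b fun i => v i),
    toPMapTop (diagOp d fun i => w i), toPMapTop (diagOp b fun i => f (v i)),
    toPMapTop (diagOp d fun i => f (w i)), toPMapTop_isSelfAdjoint (isSelfAdjoint_diagOp b v),
    toPMapTop_isSelfAdjoint (isSelfAdjoint_diagOp d w), spectrum_diagOp_subset b v hv,
    spectrum_diagOp_subset d w hw, rfl, ?_,
    ⟨diagSpectralMeasure b v, isSpectralIntegral_diagOp b v measurable_id,
      isSpectralIntegral_diagOp b v hf⟩,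
    ⟨diagSpectralMeasure d w, isSpectralIntegral_diagOp d w measurable_id,
      isSpectralIntegral_diagOp d w hf⟩, (opNorm_toPMapTop_sub _ _).symm⟩
  rw [opNorm_toPMapTop_sub]
  exact ENNReal.ofReal_le_ofReal h

end Diagonal

/-! ### Bounded operators by polynomial approximation and compression -/

section Bounded

variable {H : Type u} [NormedAddCommGroup H] [InnerProductSpace ℂ H]

theorem exists_eq_diagOp [CompleteSpace H] [FiniteDimensional ℂ H] {T : H →L[ℂ] H}
    (hT : IsSelfAdjoint T) :
    ∃ (b : OrthonormalBasis (Fin (Module.finrank ℂ H)) ℂ H) (v : Fin (Module.finrank ℂ H) → ℝ),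
      T = diagOp b (fun i => (v i : ℂ)) ∧ ∀ i, |v i| ≤ ‖T‖ := by
  have hs : (T : H →ₗ[ℂ] H).IsSymmetric := ContinuousLinearMap.isSelfAdjoint_iff_isSymmetric.1 hT
  set b := hs.eigenvectorBasis rfl
  set v := hs.eigenvalues rfl
  have hb : ∀ i, T (b i) = (v i : ℂ) • b i := hs.apply_eigenvectorBasis rfl
  refine ⟨b, v, ?_, fun i => ?_⟩
  · ext x
    refine ext_inner_orthonormalBasis b fun i => ?_
    rw [inner_diagOp]
    have : inner ℂ (b i) (T x) = inner ℂ (T (b i)) x := (hs (b i) x).symm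
    rw [this, hb, inner_smul_left, Complex.conj_ofReal]
  · have h := T.le_opNorm (b i)
    rwa [hb, norm_smul, b.norm_eq_one, mul_one, mul_one, Complex.norm_real] at h

theorem diagOp_pow {ι : Type*} [Fintype ι] (b : OrthonormalBasis ι ℂ H) (c : ι → ℂ) (n : ℕ) :
    diagOp b c ^ n = diagOp b (fun i => c i ^ n) := by
  induction n with
  | zero => simpa using (diagOp_one b).symm
  | succ n ih => simp_rw [pow_succ, ih, diagOp_mul]

theorem aeval_diagOp {ι : Type*} [Fintype ι] (b : OrthonormalBasis ι ℂ H) (v : ι → ℝ)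
    (p : Polynomial ℝ) : Polynomial.aeval (diagOp b (fun i => (v i : ℂ))) p =
      diagOp b (fun i => ((p.eval (v i) : ℝ) : ℂ)) := by
  ext x
  refine ext_inner_orthonormalBasis b fun i => ?_
  rw [Polynomial.aeval_eq_sum_range, inner_diagOp, Polynomial.eval_eq_sum_range, sum_apply, inner_sum,
    Complex.ofReal_sum, Finset.sum_mul]
  refine Finset.sum_congr rfl fun n _ => ?_
  rw [FunLike.coe_smul, Pi.smul_apply, diagOp_pow, ← Complex.coe_smul, inner_smul_right, inner_diagOp]
  push_cast
  ring

/-- The compression of an operator to a subspace. -/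
def compress (V : Submodule ℂ H) [V.HasOrthogonalProjection] (A : H →L[ℂ] H) : V →L[ℂ] V :=
  V.orthogonalProjectionOnto ∘L A ∘L V.subtypeL

theorem compress_isSelfAdjoint [CompleteSpace H] (V : Submodule ℂ H) [FiniteDimensional ℂ V] {A : H →L[ℂ] H}
    (hA : IsSelfAdjoint A) : IsSelfAdjoint (compress V A) := by
  refine ContinuousLinearMap.isSelfAdjoint_iff_isSymmetric.2 fun x y => ?_
  have hs := ContinuousLinearMap.isSelfAdjoint_iff_isSymmetric.1 hA
  simpa [compress] using hs (x : H) y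

theorem norm_compress_le (V : Submodule ℂ H) [FiniteDimensional ℂ V] (A : H →L[ℂ] H) :
    ‖compress V A‖ ≤ ‖A‖ := by
  refine ContinuousLinearMap.opNorm_le_bound _ (norm_nonneg _) fun x => ?_
  exact (V.norm_orthogonalProjectionOnto_apply_le _).trans (A.le_opNorm _)

/-- The orbit of `x` stays in V up to the power n, so the projection in the compression acts
trivially on it. -/
theorem compress_pow_apply (V : Submodule ℂ H) [FiniteDimensional ℂ V] (A : H →L[ℂ] H) {x : H}
    {n : ℕ} (h : ∀ i ≤ n, (A ^ i) x ∈ V) {i : ℕ} (hi : i ≤ n) :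
    (((compress V A) ^ i) ⟨x, h 0 (Nat.zero_le n)⟩ : H) = (A ^ i) x := by
  induction i with
  | zero => rfl
  | succ i ih =>
    have hm := h (i + 1) hi
    rw [pow_succ', mul_apply_eq_comp] at hm ⊢
    have e : (compress V A ^ i) ⟨x, h 0 (Nat.zero_le n)⟩ = ⟨(A ^ i) x, h i (by omega)⟩ :=
      Subtype.ext (ih (by omega))
    rw [e, pow_succ', mul_apply_eq_comp]
    change ((V.orthogonalProjectionOnto (A ((A ^ i) x)) : V) : H) = _
    exact congrArg Subtype.val (V.orthogonalProjectionOnto_mem_subspace_eq_self ⟨_, hm⟩)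

theorem aeval_compress_apply (V : Submodule ℂ H) [FiniteDimensional ℂ V] (A : H →L[ℂ] H) {x : H}
    (p : Polynomial ℝ) (h : ∀ i ≤ p.natDegree, (A ^ i) x ∈ V) :
    ((Polynomial.aeval (compress V A) p) ⟨x, h 0 (Nat.zero_le _)⟩ : H) =
      Polynomial.aeval A p x := by
  rw [Polynomial.aeval_eq_sum_range, Polynomial.aeval_eq_sum_range, sum_apply, sum_apply,
    Submodule.coe_sum]
  refine Finset.sum_congr rfl fun i hi => ?_
  rw [FunLike.coe_smul, Pi.smul_apply, FunLike.coe_smul, Pi.smul_apply, ← Complex.coe_smul,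
    ← Complex.coe_smul, Submodule.coe_smul,
    compress_pow_apply V A h (Nat.lt_succ_iff.1 (Finset.mem_range.1 hi))]

theorem norm_abs_sub_aeval_le [CompleteSpace H] {A : H →L[ℂ] H} (hA : IsSelfAdjoint A) {a ε : ℝ} (ha : ‖A‖ ≤ a)
    (hε : 0 ≤ ε) {p : Polynomial ℝ} (hp : ∀ r ∈ Set.Icc (-a) a, abs (p.eval r - |r|) ≤ ε) :
    ‖CFC.abs A - Polynomial.aeval A p‖ ≤ ε := by
  rw [CFC.abs_eq_cfc_norm A hA, ← cfc_polynomial p A hA, ← cfc_sub _ _ A]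
  refine norm_cfc_le hε fun r hr => ?_
  have h1 := _root_.spectrum.norm_le_norm_mul_of_mem hr
  have h2 : ‖(1 : H →L[ℂ] H)‖ ≤ 1 := ContinuousLinearMap.norm_id_le
  have h3 : |r| ≤ a := h1.trans ((mul_le_of_le_one_right (norm_nonneg _) h2).trans ha)
  rw [Real.norm_eq_abs, Real.norm_eq_abs, abs_sub_comm]
  exact hp r (abs_le.1 h3)

theorem norm_aeval_diagOp_sub_le {ι : Type*} [Fintype ι] (b : OrthonormalBasis ι ℂ H) (v : ι → ℝ)
    {a ε : ℝ} (hv : ∀ i, |v i| ≤ a) (hε : 0 ≤ ε) {p : Polynomial ℝ}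
    (hp : ∀ r ∈ Set.Icc (-a) a, abs (p.eval r - |r|) ≤ ε) :
    ‖Polynomial.aeval (diagOp b (fun i => (v i : ℂ))) p - diagOp b (fun i => ((|v i| : ℝ) : ℂ))‖
      ≤ ε := by
  rw [aeval_diagOp, diagOp_sub]
  refine norm_diagOp_le b hε fun i => ?_
  rw [← Complex.ofReal_sub, Complex.norm_real]
  exact hp _ (abs_le.1 (hv i))

/-- For a polynomial p close to |·| and a fixed vector x, p(A)x and p(B)x are computed inside a
finite-dimensional space; compression does not increase ‖A - B‖, and there the estimate on [-a, ∞)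
with a = ‖A‖ + ‖B‖ applies. -/
theorem norm_abs_sub_abs_le [CompleteSpace H] {A B : H →L[ℂ] H} (hA : IsSelfAdjoint A) (hB : IsSelfAdjoint B) :
    ‖CFC.abs A - CFC.abs B‖ ≤
      81 * ‖A - B‖ * Real.log (2 + Real.log ((‖A‖ + ‖B‖) / ‖A - B‖)) := by
  rcases eq_or_ne A B with rfl | hne
  · simp
  set δ := ‖A - B‖ with hδ
  have hδ0 : 0 < δ := norm_pos_iff.2 (sub_ne_zero.2 hne)
  set a := ‖A‖ + ‖B‖ with ha
  have hδa : δ ≤ a := norm_sub_le A B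
  have ha0 : 0 < a := hδ0.trans_le hδa
  have hA' : ‖A‖ ≤ a := le_add_of_nonneg_right (norm_nonneg _)
  have hB' : ‖B‖ ≤ a := le_add_of_nonneg_left (norm_nonneg _)
  have hlog : Real.log (a / δ) = Real.posLog (a / δ) :=
    (max_eq_right (Real.log_nonneg ((one_le_div hδ0).2 hδa))).symm
  rw [hlog]
  set M := 81 * δ * Real.log (2 + Real.posLog (a / δ)) with hM
  have hM0 : 0 ≤ M := by
    have : 0 ≤ Real.log (2 + Real.posLog (a / δ)) :=
      Real.log_nonneg (by linarith [Real.posLog_nonneg (x := a / δ)])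
    positivity
  refine le_of_forall_pos_le_add fun η hη => ?_
  -- Four replacements of |·| by p: for A, for B and for their two compressions.
  set ε := η / 4 with hε
  have hε0 : 0 < ε := by positivity
  obtain ⟨p, hp⟩ := exists_polynomial_near_of_continuousOn (-a) a (fun r => |r|)
    continuous_abs.continuousOn ε hε0
  have hp' : ∀ r ∈ Set.Icc (-a) a, abs (p.eval r - |r|) ≤ ε := fun r hr => (hp r hr).le
  refine ContinuousLinearMap.opNorm_le_bound _ (by positivity) fun x => ?_
  set S : Set H := (fun i => (A ^ i) x) '' Set.Iic p.natDegree ∪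
    (fun i => (B ^ i) x) '' Set.Iic p.natDegree with hS
  have hSf : S.Finite := ((Set.finite_Iic _).image _).union ((Set.finite_Iic _).image _)
  set V := Submodule.span ℂ S with hV
  have : FiniteDimensional ℂ V := FiniteDimensional.span_of_finite ℂ hSf
  have mA : ∀ i ≤ p.natDegree, (A ^ i) x ∈ V := fun i hi =>
    Submodule.subset_span (Or.inl ⟨i, hi, rfl⟩)
  have mB : ∀ i ≤ p.natDegree, (B ^ i) x ∈ V := fun i hi =>
    Submodule.subset_span (Or.inr ⟨i, hi, rfl⟩)
  obtain ⟨b, v, hbv, hv⟩ := exists_eq_diagOp (compress_isSelfAdjoint V hA)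
  obtain ⟨d, w, hdw, hw⟩ := exists_eq_diagOp (compress_isSelfAdjoint V hB)
  have hv' : ∀ i, |v i| ≤ a := fun i => (hv i).trans ((norm_compress_le V A).trans hA')
  have hw' : ∀ i, |w i| ≤ a := fun i => (hw i).trans ((norm_compress_le V B).trans hB')
  have hsub : compress V A - compress V B = compress V (A - B) := by
    ext y; simp [compress]
  have key : ‖diagOp b (fun i => ((|v i| : ℝ) : ℂ)) - diagOp d (fun i => ((|w i| : ℝ) : ℂ))‖ ≤ M := by
    rw [← ENNReal.ofReal_le_ofReal_iff hM0]
    refine (ofReal_norm_sub_le_operatorModulus b d (f := fun r => |r|) (by fun_prop)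
      (F := Set.Ici (-a)) (δ := δ) (fun i => (abs_le.1 (hv' i)).1)
      (fun i => (abs_le.1 (hw' i)).1) ?_).trans (operatorModulus_abs_Ici_le ha0 hδ0)
    rw [← hbv, ← hdw, hsub]
    exact norm_compress_le V _
  have c1 := norm_aeval_diagOp_sub_le b v hv' hε0.le hp'
  have c2 := norm_aeval_diagOp_sub_le d w hw' hε0.le hp'
  rw [← hbv] at c1
  rw [← hdw] at c2
  have c3 := norm_abs_sub_aeval_le hA hA' hε0.le hp'
  have c4 := norm_abs_sub_aeval_le hB hB' hε0.le hp'
  have c5 : ‖Polynomial.aeval (compress V A) p - Polynomial.aeval (compress V B) p‖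
      ≤ M + 2 * ε := by
    have e : Polynomial.aeval (compress V A) p - Polynomial.aeval (compress V B) p =
        (Polynomial.aeval (compress V A) p - diagOp b (fun i => ((|v i| : ℝ) : ℂ)))
        + (diagOp b (fun i => ((|v i| : ℝ) : ℂ)) - diagOp d (fun i => ((|w i| : ℝ) : ℂ)))
        - (Polynomial.aeval (compress V B) p - diagOp d (fun i => ((|w i| : ℝ) : ℂ))) := by abel
    rw [e]
    calc _ ≤ ε + M + ε :=
          (norm_sub_le _ _).trans (add_le_add ((norm_add_le _ _).trans (add_le_add c1 key)) c2)
      _ = _ := by ring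
  have c6 : ‖(Polynomial.aeval A p - Polynomial.aeval B p) x‖ ≤ (M + 2 * ε) * ‖x‖ := by
    rw [sub_apply, ← aeval_compress_apply V A p mA, ← aeval_compress_apply V B p mB,
      ← Submodule.coe_sub]
    exact ContinuousLinearMap.le_of_opNorm_le _ c5 _
  have e : (CFC.abs A - CFC.abs B) x = (CFC.abs A - Polynomial.aeval A p) x
      + (Polynomial.aeval A p - Polynomial.aeval B p) x - (CFC.abs B - Polynomial.aeval B p) x := by
    simp only [sub_apply]; abel
  rw [e]
  calc _ ≤ ε * ‖x‖ + (M + 2 * ε) * ‖x‖ + ε * ‖x‖ :=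
        (norm_sub_le _ _).trans (add_le_add ((norm_add_le _ _).trans
          (add_le_add (ContinuousLinearMap.le_of_opNorm_le _ c3 x) c6))
          (ContinuousLinearMap.le_of_opNorm_le _ c4 x))
    _ = (M + η) * ‖x‖ := by rw [hε]; ring

end Bounded

/-! ### Cayley transform: from commutators to differences -/

section Cayley

variable {H : Type*} [NormedAddCommGroup H] [InnerProductSpace ℂ H] [CompleteSpace H]

/-- The Cayley transform of a skew-adjoint operator `X` conjugates `T` to an operator at a distance
from `T` comparable to the norm of the commutator of `T` and `X`. -/
theorem exists_unitary_conj_of_skew [FiniteDimensional ℂ H] {X : H →L[ℂ] H} (hX : star X = -X) :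
    ∃ U ∈ unitary (H →L[ℂ] H), ∀ T : H →L[ℂ] H,
      ‖T - star U * T * U‖ ≤ 2 * ‖T * X - X * T‖ ∧
        2 * ‖T * X - X * T‖ ≤ (1 + ‖X‖) ^ 2 * ‖T - star U * T * U‖ := by
  have hre : ∀ x, (inner ℂ x (X x)).re = 0 := by
    intro x
    have h1 : inner ℂ x (X x) = inner ℂ (-X x) x := by
      rw [← ContinuousLinearMap.adjoint_inner_left, ← ContinuousLinearMap.star_eq_adjoint, hX]
      rfl
    have h2 := congrArg Complex.re h1
    have h3 : (inner ℂ (X x) x).re = (inner ℂ x (X x)).re := by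
      rw [← inner_conj_symm, Complex.conj_re]
    rw [inner_neg_left, Complex.neg_re, h3] at h2
    linarith
  have hco : ∀ x, ‖x‖ ≤ ‖(1 + X) x‖ := by
    intro x
    have h1 : (inner ℂ x ((1 + X) x)).re = ‖x‖ ^ 2 := by
      rw [add_apply, one_apply_eq_self, inner_add_right, Complex.add_re, hre, add_zero,
        inner_self_eq_norm_sq_to_K]
      norm_cast
    have h2 := (Complex.re_le_norm _).trans (norm_inner_le_norm x ((1 + X) x))
    rw [h1] at h2
    rcases eq_or_ne x 0 with rfl | hx
    · simp
    · have : 0 < ‖x‖ := norm_pos_iff.2 hx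
      nlinarith
  have hinj : Function.Injective ((1 + X : H →L[ℂ] H) : H →ₗ[ℂ] H) := by
    rw [injective_iff_map_eq_zero]
    intro x hx
    have h := hco x
    rw [show (1 + X) x = 0 from hx, norm_zero] at h
    exact norm_le_zero_iff.1 h
  let e := LinearEquiv.ofInjectiveEndo _ hinj
  let W : H →L[ℂ] H := LinearMap.toContinuousLinearMap (e.symm : H →ₗ[ℂ] H)
  have hWY : W * (1 + X) = 1 := by
    ext x
    exact e.symm_apply_apply x
  have hYW : (1 + X) * W = 1 := by
    ext x
    exact e.apply_symm_apply x
  have hW : ‖W‖ ≤ 1 := ContinuousLinearMap.opNorm_le_bound _ zero_le_one fun x => by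
    have h := hco (W x)
    rw [show (1 + X) (W x) = x from congrArg (fun f : H →L[ℂ] H => f x) hYW] at h
    linarith
  have sWY : star W * (1 - X) = 1 := by
    have h := congrArg star hYW
    rwa [star_mul, star_add, star_one, hX, ← sub_eq_add_neg] at h
  have sYW : (1 - X) * star W = 1 := by
    have h := congrArg star hWY
    rwa [star_mul, star_add, star_one, hX, ← sub_eq_add_neg] at h
  -- Here W = (1 + X)⁻¹ is a contraction because Re⟨x, X x⟩ = 0, and U is the Cayley transform of X.
  set U := (1 - X) * W with hUdef
  have hU2 : U = 2 * W - 1 := by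
    have : (2 : H →L[ℂ] H) * W - 1 = 2 * W - (1 + X) * W := by rw [hYW]
    rw [this, hUdef]; noncomm_ring
  have hsU : star U = star W * (1 + X) := by
    rw [hUdef, star_mul, star_sub, star_one, hX, sub_neg_eq_add]
  have hUU : star U * U = 1 := by
    calc star U * U = star W * ((1 + X) * (1 - X)) * W := by rw [hsU, hUdef]; noncomm_ring
      _ = star W * ((1 - X) * (1 + X)) * W := by congr 2; noncomm_ring
      _ = (star W * (1 - X)) * ((1 + X) * W) := by noncomm_ring
      _ = 1 := by rw [sWY, hYW, one_mul]
  have hWc : W * (1 - X) = (1 - X) * W := by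
    calc W * (1 - X) = W * ((1 - X) * ((1 + X) * W)) := by rw [hYW, mul_one]
      _ = W * ((1 - X) * (1 + X)) * W := by noncomm_ring
      _ = W * ((1 + X) * (1 - X)) * W := by congr 2; noncomm_ring
      _ = (W * (1 + X)) * ((1 - X) * W) := by noncomm_ring
      _ = _ := by rw [hWY, one_mul]
  have hUU' : U * star U = 1 := by
    calc U * star U = W * ((1 - X) * star W) * (1 + X) := by
          rw [hsU, hUdef, ← hWc]; noncomm_ring
      _ = 1 := by rw [sYW, mul_one, hWY]
  have hUn : ∀ V : H →L[ℂ] H, star V * V = 1 → ‖V‖ ≤ 1 := by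
    intro V hV
    have h := CStarRing.norm_star_mul_self (x := V)
    rw [hV] at h
    have h1 : ‖(1 : H →L[ℂ] H)‖ ≤ 1 := ContinuousLinearMap.norm_id_le
    nlinarith [norm_nonneg V]
  have nU := hUn U hUU
  have nsU : ‖star U‖ ≤ 1 := by rw [norm_star]; exact nU
  refine ⟨U, ⟨hUU, hUU'⟩, fun T => ?_⟩
  have e1 : T - star U * T * U = star U * (U * T - T * U) := by
    rw [mul_sub, ← mul_assoc (star U) U T, hUU, one_mul, mul_assoc]
  have e2 : U * T - T * U = U * (T - star U * T * U) := by
    rw [mul_sub, mul_assoc (star U), ← mul_assoc U (star U), hUU', one_mul]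
  -- Since U = 2W - 1, the commutator [U, T] is 2[W, T], which the resolvent identity expresses
  -- through [T, X].
  have e3 : U * T - T * U = (2 : ℂ) • (W * (T * X - X * T) * W) := by
    have h1 : W * (T * X - X * T) * W = W * T * ((1 + X) * W) - (W * (1 + X)) * T * W := by
      noncomm_ring
    rw [h1, hYW, hWY, mul_one, one_mul, hU2, two_smul]
    noncomm_ring
  have e4 : (2 : ℂ) • (T * X - X * T) = (1 + X) * (U * T - T * U) * (1 + X) := by
    rw [e3, mul_smul_comm, smul_mul_assoc]
    congr 1
    calc T * X - X * T = 1 * (T * X - X * T) * 1 := by simp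
      _ = ((1 + X) * W) * (T * X - X * T) * (W * (1 + X)) := by rw [hYW, hWY]
      _ = _ := by noncomm_ring
  have nY : ‖1 + X‖ ≤ 1 + ‖X‖ :=
    (norm_add_le _ _).trans (add_le_add_left ContinuousLinearMap.norm_id_le _)
  constructor
  · calc ‖T - star U * T * U‖ ≤ 1 * ‖U * T - T * U‖ := by
          rw [e1]; exact (norm_mul_le _ _).trans (by gcongr)
      _ = 2 * ‖W * (T * X - X * T) * W‖ := by rw [e3, norm_smul]; simp
      _ ≤ 2 * (1 * ‖T * X - X * T‖ * 1) := by
          gcongr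
          refine (norm_mul_le _ _).trans ?_
          gcongr
          exact (norm_mul_le _ _).trans (by gcongr)
      _ = _ := by ring
  · have h1 : 2 * ‖T * X - X * T‖ = ‖(2 : ℂ) • (T * X - X * T)‖ := by rw [norm_smul]; simp
    have h2 : ‖U * T - T * U‖ ≤ 1 * ‖T - star U * T * U‖ := by
      rw [e2]; exact (norm_mul_le _ _).trans (by gcongr)
    rw [h1, e4]
    calc _ ≤ (1 + ‖X‖) * (1 * ‖T - star U * T * U‖) * (1 + ‖X‖) := by
          refine (norm_mul_le _ _).trans ?_
          gcongr
          exact (norm_mul_le _ _).trans (by gcongr)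
      _ = _ := by ring

end Cayley

/-! ### Hilbert's inequality via the sawtooth function -/

section HilbertInequality

open Real Complex intervalIntegral

theorem integral_cexp_two_pi_I (m : ℤ) :
    ∫ t in (0 : ℝ)..1, cexp (2 * π * I * m * t) = if m = 0 then 1 else 0 := by
  split_ifs with h
  · simp [h]
  · have hc : 2 * π * I * (m : ℂ) ≠ 0 :=
      mul_ne_zero Complex.two_pi_I_ne_zero (Int.cast_ne_zero.2 h)
    rw [integral_exp_mul_complex hc]
    have : cexp (2 * π * I * (m : ℂ)) = 1 := by
      rw [mul_comm]; exact Complex.exp_int_mul_two_pi_mul_I m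
    simp [this]

/-- For m = 0 both sides vanish, the right one by the convention 1/0 = 0; hence the diagonal of the
Hilbert form needs no separate treatment. -/
theorem integral_cexp_mul_sub_half (m : ℤ) :
    ∫ t in (0 : ℝ)..1, cexp (2 * π * I * m * t) * ((t - 1 / 2 : ℝ) : ℂ) = 1 / (2 * π * I * m) := by
  have h := bernoulliFourierCoeff_eq one_ne_zero (-m)
  rw [bernoulliFourierCoeff, fourierCoeffOn_eq_integral] at h
  simp only [neg_neg, sub_zero, div_one, one_smul, fourier_coe_apply, bernoulliFun_one,
    Nat.factorial_one, pow_one, smul_eq_mul] at h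
  have e : (1 : ℂ) / (2 * π * I * m) = -((1 : ℕ) : ℂ) / (2 * π * I * ((-m : ℤ) : ℂ)) := by
    push_cast
    rw [mul_neg, neg_div_neg_eq]
  rw [e, ← h]
  refine intervalIntegral.integral_congr fun t _ => ?_
  simp

/-- Hilbert's inequality. -/
theorem norm_sum_div_sub_le {n : ℕ} (x : Fin n → ℂ) :
    ‖∑ j, ∑ k, (starRingEnd ℂ) (x j) * x k / (((k : ℕ) : ℂ) - ((j : ℕ) : ℂ))‖
      ≤ π * ∑ j, ‖x j‖ ^ 2 := by
  set F : ℝ → ℂ := fun t => ∑ k, x k * cexp (2 * π * I * ((k : ℕ) : ℤ) * t) with hF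
  have hFc : Continuous F := by rw [hF]; fun_prop
  have hFF : ∀ t, ((‖F t‖ ^ 2 : ℝ) : ℂ) = ∑ j, ∑ k, (starRingEnd ℂ) (x j) * x k *
      cexp (2 * π * I * ((((k : ℕ) : ℤ) - ((j : ℕ) : ℤ) : ℤ) : ℂ) * t) := by
    intro t
    rw [Complex.ofReal_pow, ← Complex.conj_mul', hF, map_sum, Finset.sum_mul_sum]
    refine Finset.sum_congr rfl fun j _ => Finset.sum_congr rfl fun k _ => ?_
    rw [map_mul, ← Complex.exp_conj]
    have : (starRingEnd ℂ) (2 * π * I * (((j : ℕ) : ℤ) : ℂ) * t) =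
        -(2 * π * I * (((j : ℕ) : ℤ) : ℂ) * t) := by
      simp only [map_mul, map_ofNat, Complex.conj_ofReal, Complex.conj_I, map_intCast]
      ring
    rw [this]
    have e : cexp (2 * π * I * ((((k : ℕ) : ℤ) - ((j : ℕ) : ℤ) : ℤ) : ℂ) * t) =
        cexp (-(2 * π * I * (((j : ℕ) : ℤ) : ℂ) * t)) * cexp (2 * π * I * ((k : ℕ) : ℤ) * t) := by
      rw [← Complex.exp_add]; congr 1; push_cast; ring
    rw [e]; ring
  have hint : ∀ g : ℝ → ℝ, Continuous g → ∫ t in (0 : ℝ)..1, ((‖F t‖ ^ 2 * g t : ℝ) : ℂ) =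
      ∑ j, ∑ k, (starRingEnd ℂ) (x j) * x k * ∫ t in (0 : ℝ)..1,
        cexp (2 * π * I * ((((k : ℕ) : ℤ) - ((j : ℕ) : ℤ) : ℤ) : ℂ) * t) * (g t : ℂ) := by
    intro g hg
    simp_rw [Complex.ofReal_mul, hFF, Finset.sum_mul, mul_assoc _ (cexp _) _]
    rw [intervalIntegral.integral_finsetSum]
    · refine Finset.sum_congr rfl fun j _ => ?_
      rw [intervalIntegral.integral_finsetSum]
      · refine Finset.sum_congr rfl fun k _ => ?_
        rw [intervalIntegral.integral_const_mul]
      · exact fun k _ => Continuous.intervalIntegrable (by fun_prop) _ _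
    · exact fun j _ => Continuous.intervalIntegrable (by fun_prop) _ _
  have h1 := hint (fun t => t - 1 / 2) (by fun_prop)
  simp_rw [integral_cexp_mul_sub_half] at h1
  have h2 := hint (fun _ => 1) (by fun_prop)
  simp only [Complex.ofReal_one, mul_one, integral_cexp_two_pi_I] at h2
  have h3 : ∫ t in (0 : ℝ)..1, ‖F t‖ ^ 2 = ∑ j, ‖x j‖ ^ 2 := by
    rw [← Complex.ofReal_inj, ← intervalIntegral.integral_ofReal, h2, Complex.ofReal_sum]
    refine Finset.sum_congr rfl fun j _ => ?_
    rw [Finset.sum_eq_single j]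
    · simp [Complex.conj_mul']
    · intro k _ hk
      have : ((k : ℕ) : ℤ) - ((j : ℕ) : ℤ) ≠ 0 := by
        rw [sub_ne_zero]; exact_mod_cast fun h => hk (Fin.ext h)
      simp [this]
    · simp
  -- The form is 2πi ∫ |F|² (t - 1/2); as |t - 1/2| ≤ 1/2, Parseval (`h3`) gives the constant π.
  have h4 : ∑ j, ∑ k, (starRingEnd ℂ) (x j) * x k / (((k : ℕ) : ℂ) - ((j : ℕ) : ℂ)) =
      (2 * π * I) * ∫ t in (0 : ℝ)..1, ((‖F t‖ ^ 2 * (t - 1 / 2) : ℝ) : ℂ) := by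
    rw [h1, Finset.mul_sum]
    refine Finset.sum_congr rfl fun j _ => ?_
    rw [Finset.mul_sum]
    refine Finset.sum_congr rfl fun k _ => ?_
    have h0 := Complex.two_pi_I_ne_zero
    push_cast
    rw [one_div, mul_inv, div_eq_mul_inv]
    field_simp
  rw [h4, norm_mul]
  have h5 : ‖∫ t in (0 : ℝ)..1, ((‖F t‖ ^ 2 * (t - 1 / 2) : ℝ) : ℂ)‖ ≤
      ∫ t in (0 : ℝ)..1, ‖F t‖ ^ 2 * (1 / 2) := by
    refine intervalIntegral.norm_integral_le_of_norm_le zero_le_one ?_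
      (Continuous.intervalIntegrable (by fun_prop) _ _)
    refine Filter.Eventually.of_forall fun t ht => ?_
    rw [Complex.norm_real, Real.norm_eq_abs, abs_mul, abs_of_nonneg (by positivity)]
    gcongr
    rw [abs_le]
    constructor <;> linarith [ht.1, ht.2]
  rw [intervalIntegral.integral_mul_const, h3] at h5
  have h6 : ‖2 * (π : ℂ) * I‖ = 2 * π := by
    simp [abs_of_pos Real.pi_pos]
  rw [h6]
  nlinarith [Real.pi_pos]

end HilbertInequality

/-! ### Operators given by matrices -/

section MatrixOperator

open InnerProductSpace

variable {H : Type*} [NormedAddCommGroup H] [InnerProductSpace ℂ H]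
  {ι : Type*} [Fintype ι] (b : OrthonormalBasis ι ℂ H)

/-- The operator with a given matrix in an orthonormal basis. -/
def matOp (c : ι → ι → ℂ) : H →L[ℂ] H := ∑ i, ∑ j, c i j • rankOne ℂ (b i) (b j)

theorem inner_matOp (c : ι → ι → ℂ) (i : ι) (x : H) :
    inner ℂ (b i) (matOp b c x) = ∑ j, c i j * inner ℂ (b j) x := by
  classical
  simp only [matOp, sum_apply, FunLike.coe_smul, Pi.smul_apply, rankOne_apply, inner_sum,
    inner_smul_right, orthonormal_iff_ite.1 b.orthonormal]
  rw [Finset.sum_comm]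
  simp

theorem inner_matOp_right (c : ι → ι → ℂ) (x y : H) :
    inner ℂ x (matOp b c y) =
      ∑ i, ∑ j, (starRingEnd ℂ) (inner ℂ (b i) x) * inner ℂ (b j) y * c i j := by
  rw [← b.sum_inner_mul_inner x]
  refine Finset.sum_congr rfl fun i _ => ?_
  rw [inner_matOp, inner_conj_symm, Finset.mul_sum]
  exact Finset.sum_congr rfl fun j _ => by ring

theorem inner_matOp_left (c : ι → ι → ℂ) (x y : H) :
    inner ℂ (matOp b c x) y = inner ℂ x (matOp b (fun i j => (starRingEnd ℂ) (c j i)) y) := by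
  rw [← inner_conj_symm, inner_matOp_right, inner_matOp_right, map_sum, Finset.sum_comm]
  simp only [map_sum, map_mul, Complex.conj_conj]
  rw [Finset.sum_comm]
  rw [Finset.sum_comm]
  exact Finset.sum_congr rfl fun i _ => Finset.sum_congr rfl fun j _ => by ring

theorem diagOp_mul_matOp (v : ι → ℂ) (c : ι → ι → ℂ) :
    diagOp b v * matOp b c = matOp b (fun i j => v i * c i j) := by
  ext x
  refine ext_inner_orthonormalBasis b fun i => ?_
  rw [mul_apply_eq_comp, inner_diagOp, inner_matOp, inner_matOp, Finset.mul_sum]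
  exact Finset.sum_congr rfl fun j _ => by ring

theorem matOp_mul_diagOp (v : ι → ℂ) (c : ι → ι → ℂ) :
    matOp b c * diagOp b v = matOp b (fun i j => c i j * v j) := by
  ext x
  refine ext_inner_orthonormalBasis b fun i => ?_
  rw [mul_apply_eq_comp, inner_matOp, inner_matOp]
  exact Finset.sum_congr rfl fun j _ => by rw [inner_diagOp]; ring

theorem matOp_add (c e : ι → ι → ℂ) :
    matOp b c + matOp b e = matOp b (fun i j => c i j + e i j) := by
  simp only [matOp, add_smul, Finset.sum_add_distrib]

theorem matOp_sub (c e : ι → ι → ℂ) :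
    matOp b c - matOp b e = matOp b (fun i j => c i j - e i j) := by
  simp only [matOp, sub_smul, Finset.sum_sub_distrib]

/-- Conjugating a diagonal operator by a unitary changes its basis. -/
theorem exists_diagOp_eq_conj [CompleteSpace H] {U : H →L[ℂ] H} (hU : U ∈ unitary (H →L[ℂ] H)) :
    ∃ d : OrthonormalBasis ι ℂ H, ∀ c, diagOp d c = star U * diagOp b c * U := by
  let e : H ≃ₗᵢ[ℂ] H := Unitary.linearIsometryEquiv (star ⟨U, hU⟩ : unitary (H →L[ℂ] H))
  have he : ∀ x, e x = star U x := fun _ => rfl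
  refine ⟨b.map e, fun c => ?_⟩
  ext x
  rw [diagOp_apply, mul_apply_eq_comp, mul_apply_eq_comp, diagOp_apply, map_sum]
  refine Finset.sum_congr rfl fun i _ => ?_
  rw [OrthonormalBasis.map_apply, he, map_smul, map_smul, ContinuousLinearMap.star_eq_adjoint,
    ContinuousLinearMap.adjoint_inner_left]

end MatrixOperator

/-! ### The extremal pair built from the odd Hilbert matrix -/

section HilbertMatrix

open Complex

/-- The sign `(-1) ^ i`. -/
def altSign (i : ℕ) : ℝ := (-1) ^ i

theorem altSign_mul_self (i : ℕ) : altSign i * altSign i = 1 := by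
  rw [altSign, ← pow_add, Even.neg_one_pow ⟨i, rfl⟩]

theorem abs_altSign (i : ℕ) : |altSign i| = 1 := by simp [altSign]

theorem altSign_eq_neg {i j : ℕ} (h : Odd (i + j)) : altSign j = -altSign i := by
  have h1 : altSign i * altSign j = -1 := by rw [altSign, altSign, ← pow_add, h.neg_one_pow]
  linear_combination altSign i * h1 - altSign j * altSign_mul_self i

theorem altSign_eq {i j : ℕ} (h : ¬ Odd (i + j)) : altSign j = altSign i := by
  have h1 : altSign i * altSign j = 1 := by
    rw [altSign, altSign, ← pow_add, (Nat.not_odd_iff_even.1 h).neg_one_pow]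
  linear_combination altSign i * h1 - altSign j * altSign_mul_self i

/-- The odd part of the Hilbert matrix. -/
def hilbertEntry (i j : ℕ) : ℂ := if Odd (i + j) then I / ((i : ℂ) - j) else 0

/-- The odd part is half the difference of the Hilbert matrix and its conjugate by the signs, so it
inherits Hilbert's bound. -/
theorem hilbertEntry_eq (i j : ℕ) :
    hilbertEntry i j = -I / 2 * ((1 - altSign i * altSign j) / ((j : ℂ) - i)) := by
  have hs : ((altSign i : ℝ) : ℂ) * altSign i = 1 := by exact_mod_cast altSign_mul_self i
  rw [hilbertEntry]
  split_ifs with h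
  · rw [altSign_eq_neg h]
    push_cast
    rw [mul_neg, hs, ← neg_sub (j : ℂ) i, div_neg]
    ring
  · rw [altSign_eq h, hs]; simp

theorem conj_hilbertEntry (i j : ℕ) : (starRingEnd ℂ) (hilbertEntry j i) = hilbertEntry i j := by
  rw [hilbertEntry_eq, hilbertEntry_eq]
  simp only [map_mul, map_div₀, map_sub, map_neg, conj_I, map_one, map_natCast, conj_ofReal,
    map_ofNat]
  rw [← neg_sub (i : ℂ) j, div_neg]
  ring

/-- The eigenvalue `(-1) ^ i 2 ^ i`. -/
def altPow (i : ℕ) : ℝ := altSign i * 2 ^ i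

theorem abs_altPow (i : ℕ) : |altPow i| = 2 ^ i := by
  rw [altPow, abs_mul, abs_altSign, one_mul, abs_of_nonneg (by positivity)]

theorem altPow_sub {i j : ℕ} (h : Odd (i + j)) :
    altPow i - altPow j = altSign i * (2 ^ i + 2 ^ j) := by
  rw [altPow, altPow, altSign_eq_neg h]; ring

theorem altPow_sub_ne {i j : ℕ} (h : Odd (i + j)) : ((altPow i : ℝ) : ℂ) - altPow j ≠ 0 := by
  rw [← ofReal_sub, altPow_sub h, ofReal_ne_zero]
  have h1 : altSign i ≠ 0 := fun h0 => by simpa [h0] using altSign_mul_self i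
  positivity

/-- The solution of the commutator equation for the odd Hilbert matrix. -/
def divEntry (i j : ℕ) : ℂ := hilbertEntry i j / (altPow i - altPow j)

theorem commutator_entry (i j : ℕ) :
    (altPow i : ℂ) * divEntry i j - divEntry i j * altPow j = hilbertEntry i j := by
  by_cases h : Odd (i + j)
  · rw [divEntry, mul_comm, ← mul_sub, div_mul_cancel₀ _ (altPow_sub_ne h)]
  · simp [divEntry, hilbertEntry, h]

/-- For i + j odd the eigenvalues have opposite signs, so |λᵢ| + |λⱼ| cancels the denominator λᵢ -
λⱼ up to the sign of λᵢ. -/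
theorem anticommutator_entry (i j : ℕ) :
    ((|altPow i| : ℝ) : ℂ) * divEntry i j + divEntry i j * ((|altPow j| : ℝ) : ℂ) =
      altSign i * hilbertEntry i j := by
  by_cases h : Odd (i + j)
  · have hn := altPow_sub_ne h
    have hs : ((altSign i : ℝ) : ℂ) * altSign i = 1 := by exact_mod_cast altSign_mul_self i
    rw [divEntry, abs_altPow, abs_altPow, mul_comm, ← mul_add, div_mul_eq_mul_div,
      div_eq_iff hn, ← ofReal_sub, altPow_sub h]
    push_cast
    linear_combination -(hilbertEntry i j * (2 ^ i + 2 ^ j)) * hs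
  · simp [divEntry, hilbertEntry, h]

theorem conj_divEntry (i j : ℕ) : (starRingEnd ℂ) (divEntry j i) = -divEntry i j := by
  rw [divEntry, divEntry, map_div₀, conj_hilbertEntry, map_sub, conj_ofReal, conj_ofReal,
    ← neg_sub ((altPow i : ℝ) : ℂ), div_neg]

/-- The entries of the commutator with the modulus. -/
def absEntry (i j : ℕ) : ℝ :=
  if Odd (i + j) then (2 ^ i - 2 ^ j) / (2 ^ i + 2 ^ j) / ((i : ℝ) - j) else 0

/-- The difference |λᵢ| - |λⱼ| is antisymmetric like 1/(i - j), so the cancellation in the Hilbert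
matrix is lost and the entries become nonnegative up to a unimodular row factor. -/
theorem abs_commutator_entry (i j : ℕ) :
    (altSign i : ℂ) * (((|altPow i| : ℝ) : ℂ) * divEntry i j - divEntry i j * ((|altPow j| : ℝ) : ℂ))
      = I * absEntry i j := by
  by_cases h : Odd (i + j)
  · have hn := altPow_sub_ne h
    have hs : ((altSign i : ℝ) : ℂ) * altSign i = 1 := by exact_mod_cast altSign_mul_self i
    have hs0 : ((altSign i : ℝ) : ℂ) ≠ 0 := fun h0 => by simp [h0] at hs
    have hp : (2 : ℂ) ^ i + 2 ^ j ≠ 0 := by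
      have : (2 : ℝ) ^ i + 2 ^ j ≠ 0 := by positivity
      exact_mod_cast this
    rw [divEntry, hilbertEntry, absEntry, if_pos h, if_pos h, abs_altPow, abs_altPow, ← ofReal_sub,
      altPow_sub h]
    push_cast
    rcases eq_or_ne ((i : ℂ) - j) 0 with h0 | h0
    · simp [h0]
    · field_simp
  · simp [divEntry, hilbertEntry, absEntry, h]

theorem absEntry_nonneg (i j : ℕ) : 0 ≤ absEntry i j := by
  rw [absEntry]
  split_ifs
  · rcases le_total i j with h | h
    · have h1 : (2 : ℝ) ^ i ≤ 2 ^ j := pow_le_pow_right₀ (by norm_num) h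
      have h2 : (i : ℝ) ≤ j := by exact_mod_cast h
      exact div_nonneg_of_nonpos (div_nonpos_of_nonpos_of_nonneg (by linarith) (by positivity))
        (by linarith)
    · have h1 : (2 : ℝ) ^ j ≤ 2 ^ i := pow_le_pow_right₀ (by norm_num) h
      have h2 : (j : ℝ) ≤ i := by exact_mod_cast h
      exact div_nonneg (div_nonneg (by linarith) (by positivity)) (by linarith)
  · exact le_rfl

/-- The quotient of powers is at least 1/3 because 2^i ≥ 2 · 2^j, and 2m + 1 ≤ 2(m + 1). -/
theorem le_absEntry {i m : ℕ} (h : 2 * m + 1 ≤ i) :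
    1 / 6 * ((m : ℝ) + 1)⁻¹ ≤ absEntry i (i - (2 * m + 1)) := by
  obtain ⟨j, rfl⟩ := Nat.exists_eq_add_of_le h
  have e : 2 * m + 1 + j - (2 * m + 1) = j := by omega
  have ho : Odd (2 * m + 1 + j + j) := ⟨m + j, by ring⟩
  rw [e, absEntry, if_pos ho]
  have hj : (0 : ℝ) < 2 ^ j := by positivity
  have hp : (2 : ℝ) * 2 ^ j ≤ 2 ^ (2 * m + 1 + j) := by
    rw [← pow_succ']; exact pow_le_pow_right₀ (by norm_num) (by omega)
  have h1 : (1 : ℝ) / 3 ≤ (2 ^ (2 * m + 1 + j) - 2 ^ j) / (2 ^ (2 * m + 1 + j) + 2 ^ j) := by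
    rw [div_le_div_iff₀ (by norm_num) (by positivity)]; linarith
  have h2 : ((2 * m + 1 + j : ℕ) : ℝ) - j = 2 * m + 1 := by push_cast; ring
  rw [h2]
  calc 1 / 6 * ((m : ℝ) + 1)⁻¹ = (1 / 3) / (2 * m + 2) := by field_simp; norm_num
    _ ≤ _ := by gcongr; norm_num

/-- Each of the 2N rows with i ≥ 2N contains the N columns i - (2m + 1), m < N, whose entries
dominate a harmonic sum. -/
theorem le_sum_absEntry (N : ℕ) :
    N * Real.log (N + 1) / 3 ≤
      ∑ i ∈ Finset.range (4 * N), ∑ j ∈ Finset.range (4 * N), absEntry i j := by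
  have hh : Real.log (N + 1) ≤ ∑ m ∈ Finset.range N, ((m : ℝ) + 1)⁻¹ := by
    have h := log_add_one_le_harmonic N
    rw [harmonic] at h
    push_cast at h
    exact_mod_cast h
  have h1 : ∀ i ∈ Finset.Ico (2 * N) (4 * N), Real.log (N + 1) / 6 ≤
      ∑ j ∈ Finset.range (4 * N), absEntry i j := by
    intro i hi
    rw [Finset.mem_Ico] at hi
    have hinj : Set.InjOn (fun m => i - (2 * m + 1)) (Finset.range N : Set ℕ) := by
      intro m hm m' hm' h
      simp only [Finset.coe_range, Set.mem_Iio] at hm hm' h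
      omega
    calc Real.log (N + 1) / 6 ≤ ∑ m ∈ Finset.range N, 1 / 6 * ((m : ℝ) + 1)⁻¹ := by
          rw [← Finset.mul_sum]; linarith
      _ ≤ ∑ m ∈ Finset.range N, absEntry i (i - (2 * m + 1)) :=
          Finset.sum_le_sum fun m hm => le_absEntry (by rw [Finset.mem_range] at hm; omega)
      _ = ∑ j ∈ (Finset.range N).image (fun m => i - (2 * m + 1)), absEntry i j :=
          (Finset.sum_image hinj).symm
      _ ≤ _ := by
          refine Finset.sum_le_sum_of_subset_of_nonneg (fun j hj => ?_)
            fun _ _ _ => absEntry_nonneg _ _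
          obtain ⟨m, _, rfl⟩ := Finset.mem_image.1 hj
          rw [Finset.mem_range]; omega
  calc N * Real.log (N + 1) / 3 = ∑ _i ∈ Finset.Ico (2 * N) (4 * N), Real.log (N + 1) / 6 := by
        rw [Finset.sum_const, Nat.card_Ico, nsmul_eq_mul, show 4 * N - 2 * N = 2 * N by omega]
        push_cast; ring
    _ ≤ ∑ i ∈ Finset.Ico (2 * N) (4 * N), ∑ j ∈ Finset.range (4 * N), absEntry i j :=
        Finset.sum_le_sum h1
    _ ≤ _ := Finset.sum_le_sum_of_subset_of_nonneg
        (fun i hi => by rw [Finset.mem_Ico] at hi; rw [Finset.mem_range]; omega)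
        fun _ _ _ => Finset.sum_nonneg fun _ _ => absEntry_nonneg _ _

variable {H : Type*} [NormedAddCommGroup H] [InnerProductSpace ℂ H] {n : ℕ}
  (b : OrthonormalBasis (Fin n) ℂ H)

theorem norm_hilbertOp_le : ‖matOp b (fun i j => hilbertEntry i j)‖ ≤ Real.pi := by
  refine norm_le_of_abs_re_inner_le (fun x y => ?_) Real.pi_pos.le fun x => ?_
  · rw [inner_matOp_left]
    simp only [conj_hilbertEntry]
  · refine (abs_re_le_norm _).trans ?_
    have h1 := norm_sum_div_sub_le fun k => inner ℂ (b k) x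
    have h2 := norm_sum_div_sub_le fun k => (altSign k : ℂ) * inner ℂ (b k) x
    have h3 : ∀ k : Fin n, ‖(altSign k : ℂ) * inner ℂ (b k) x‖ = ‖inner ℂ (b k) x‖ := fun k => by
      rw [norm_mul, norm_real, Real.norm_eq_abs, abs_altSign, one_mul]
    simp only [h3, b.sum_sq_norm_inner_right] at h1 h2
    set Q : (Fin n → ℂ) → ℂ := fun z => ∑ j, ∑ k,
      (starRingEnd ℂ) (z j) * z k / (((k : ℕ) : ℂ) - ((j : ℕ) : ℂ)) with hQ
    have e : inner ℂ x (matOp b (fun i j => hilbertEntry i j) x) = -I / 2 *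
        (Q (fun k => inner ℂ (b k) x) - Q fun k => (altSign k : ℂ) * inner ℂ (b k) x) := by
      rw [inner_matOp_right, hQ, ← Finset.sum_sub_distrib, Finset.mul_sum]
      refine Finset.sum_congr rfl fun j _ => ?_
      rw [← Finset.sum_sub_distrib, Finset.mul_sum]
      refine Finset.sum_congr rfl fun k _ => ?_
      rw [hilbertEntry_eq, map_mul, conj_ofReal]
      ring
    rw [e, norm_mul]
    have h4 : ‖-I / 2‖ = 1 / 2 := by simp
    rw [h4]
    have h5 := norm_sub_le (Q fun k => inner ℂ (b k) x)
      (Q fun k => (altSign k : ℂ) * inner ℂ (b k) x)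
    have h6 : ‖Q fun k => inner ℂ (b k) x‖ ≤ Real.pi * ‖x‖ ^ 2 := h1
    have h7 : ‖Q fun k => (altSign k : ℂ) * inner ℂ (b k) x‖ ≤ Real.pi * ‖x‖ ^ 2 := h2
    linarith

/-- Sylvester's bound for the anticommutator with |D| ≥ 1 gives 2‖X‖ ≤ π. -/
theorem norm_divOp_le [CompleteSpace H] : ‖matOp b (fun i j => divEntry i j)‖ ≤ 2 := by
  set P := diagOp b (fun i => ((|altPow i| : ℝ) : ℂ)) with hP
  have hP1 : ∀ x, 1 * ‖x‖ ^ 2 ≤ (inner ℂ x (P x)).re := by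
    intro x
    rw [hP, diagOp_apply, inner_sum, re_sum, one_mul, ← b.sum_sq_norm_inner_right]
    refine Finset.sum_le_sum fun i _ => ?_
    rw [inner_smul_right, inner_smul_right, ← inner_conj_symm x, mul_conj', re_ofReal_mul,
      ← ofReal_pow, ofReal_re, abs_altPow]
    exact le_mul_of_one_le_left (by positivity) (one_le_pow₀ (by norm_num))
  have hS : ‖diagOp b (fun i => ((altSign i : ℝ) : ℂ))‖ ≤ 1 :=
    norm_diagOp_le b zero_le_one fun i => by rw [norm_real, Real.norm_eq_abs, abs_altSign]
  have h := norm_le_of_sylvester zero_le_one hP1 hP1 (Z := matOp b (fun i j => divEntry i j))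
    (K := diagOp b (fun i => ((altSign i : ℝ) : ℂ)) * matOp b (fun i j => hilbertEntry i j)) (by
      rw [hP, diagOp_mul_matOp, matOp_mul_diagOp, matOp_add, diagOp_mul_matOp]
      simp only [anticommutator_entry])
  have h2 : ‖diagOp b (fun i => ((altSign i : ℝ) : ℂ)) * matOp b (fun i j => hilbertEntry i j)‖
      ≤ 1 * Real.pi := (norm_mul_le _ _).trans
    (mul_le_mul hS (norm_hilbertOp_le b) (norm_nonneg _) zero_le_one)
  linarith [Real.pi_le_four]

/-- Testing against the constant vector and the vector of signs, both of squared norm 4N, sums all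
entries without cancellation. -/
theorem le_norm_abs_commutator {N : ℕ} (hN : 1 ≤ N) (b : OrthonormalBasis (Fin (4 * N)) ℂ H) :
    Real.log (N + 1) / 12 ≤
      ‖matOp b (fun i j => ((|altPow i| : ℝ) : ℂ) * divEntry i j
        - divEntry i j * ((|altPow j| : ℝ) : ℂ))‖ := by
  set L := matOp b (fun i j => ((|altPow i| : ℝ) : ℂ) * divEntry i j
        - divEntry i j * ((|altPow j| : ℝ) : ℂ))
  set x : H := ∑ i, b i
  set y : H := ∑ i, ((altSign (i : Fin (4 * N)) : ℝ) : ℂ) • b i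
  have hx : ∀ i, inner ℂ (b i) x = 1 := fun i => by
    simp [x, orthonormal_iff_ite.1 b.orthonormal]
  have hy : ∀ i, inner ℂ (b i) y = altSign i := fun i => by
    simp [y, orthonormal_iff_ite.1 b.orthonormal]
  have nx : ‖x‖ ^ 2 = 4 * N := by
    rw [← b.sum_sq_norm_inner_right]; simp [hx]
  have ny : ‖y‖ ^ 2 = 4 * N := by
    rw [← b.sum_sq_norm_inner_right]; simp [hy, abs_altSign]
  have e : inner ℂ y (L x) = I * ((∑ i ∈ Finset.range (4 * N), ∑ j ∈ Finset.range (4 * N),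
      absEntry i j : ℝ) : ℂ) := by
    rw [inner_matOp_right, ← Fin.sum_univ_eq_sum_range
      (fun i => ∑ j ∈ Finset.range (4 * N), absEntry i j), ofReal_sum, Finset.mul_sum]
    refine Finset.sum_congr rfl fun i _ => ?_
    rw [← Fin.sum_univ_eq_sum_range (fun j => absEntry i j), ofReal_sum, Finset.mul_sum]
    refine Finset.sum_congr rfl fun j _ => ?_
    rw [hx, hy, conj_ofReal, mul_one, abs_commutator_entry]
  have h1 : ‖inner ℂ y (L x)‖ ≤ 4 * N * ‖L‖ := by
    calc _ ≤ ‖y‖ * (‖L‖ * ‖x‖) := (norm_inner_le_norm _ _).trans (by gcongr; exact L.le_opNorm x)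
      _ = ‖y‖ * ‖x‖ * ‖L‖ := by ring
      _ ≤ 4 * N * ‖L‖ := by
          have : ‖y‖ * ‖x‖ ≤ 4 * N := by nlinarith [sq_nonneg (‖x‖ - ‖y‖)]
          gcongr
  rw [e, norm_mul, norm_I, one_mul, norm_real, Real.norm_of_nonneg
    (Finset.sum_nonneg fun _ _ => Finset.sum_nonneg fun _ _ => absEntry_nonneg _ _)] at h1
  have h2 := (le_sum_absEntry N).trans h1
  have hN' : (0 : ℝ) < N := by exact_mod_cast hN
  have h3 : (N : ℝ) * (Real.log (N + 1) / 12) ≤ N * ‖L‖ := by linarith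
  exact le_of_mul_le_mul_left h3 hN'

/-- Diagonal operators with close difference and moduli far apart. -/
theorem exists_orthonormalBasis_pair [CompleteSpace H] {N : ℕ} (hN : 1 ≤ N)
    (b : OrthonormalBasis (Fin (4 * N)) ℂ H) :
    ∃ d : OrthonormalBasis (Fin (4 * N)) ℂ H,
      ‖diagOp b (fun i => (altPow i : ℂ)) - diagOp d (fun i => (altPow i : ℂ))‖ ≤ 8 ∧
      Real.log (N + 1) / 54 ≤ ‖diagOp b (fun i => ((|altPow i| : ℝ) : ℂ)) -
        diagOp d (fun i => ((|altPow i| : ℝ) : ℂ))‖ := by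
  have : FiniteDimensional ℂ H := b.toBasis.finiteDimensional_of_finite
  set X := matOp b (fun i j => divEntry i j) with hX
  have hskew : star X = -X := by
    rw [ContinuousLinearMap.star_eq_adjoint, eq_comm, ContinuousLinearMap.eq_adjoint_iff]
    intro x y
    rw [hX, inner_matOp_right, neg_apply, inner_neg_left, inner_matOp_left, inner_matOp_right]
    simp only [conj_divEntry, mul_neg, Finset.sum_neg_distrib, neg_neg]
  obtain ⟨U, hU, h⟩ := exists_unitary_conj_of_skew hskew
  obtain ⟨d, hd⟩ := exists_diagOp_eq_conj b hU
  refine ⟨d, ?_, ?_⟩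
  · have h1 := (h (diagOp b fun i => (altPow i : ℂ))).1
    rw [hX, diagOp_mul_matOp, matOp_mul_diagOp, matOp_sub, ← hd] at h1
    simp only [commutator_entry] at h1
    linarith [norm_hilbertOp_le b, Real.pi_le_four]
  · have h1 := (h (diagOp b fun i => ((|altPow i| : ℝ) : ℂ))).2
    have h2 := le_norm_abs_commutator hN b
    -- The factor 9 together with log(N + 1)/12 yields 2/(9 · 12) = 1/54.
    have h3 : (1 + ‖X‖) ^ 2 ≤ 3 ^ 2 := by
      gcongr
      linarith [norm_divOp_le b]
    nth_rw 1 2 [hX] at h1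
    rw [diagOp_mul_matOp, matOp_mul_diagOp, matOp_sub, ← hd] at h1
    have h4 := mul_le_mul_of_nonneg_right h3 (norm_nonneg
      (diagOp b (fun i => ((|altPow i| : ℝ) : ℂ)) - diagOp d (fun i => ((|altPow i| : ℝ) : ℂ))))
    linarith

end HilbertMatrix

/-! ### Scaling and the lower bounds -/

section Lower

theorem operatorModulus_mono {f : ℝ → ℝ} {F G : Set ℝ} (h : F ⊆ G) (δ : ℝ) :
    operatorModulus.{u} f F δ ≤ operatorModulus.{u} f G δ := by
  refine sSup_le_sSup ?_
  rintro r ⟨H, i₁, i₂, i₃, A, B, fA, fB, hA, hB, sA, sB, hr⟩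
  exact ⟨H, i₁, i₂, i₃, A, B, fA, fB, hA, hB, sA.trans (Set.image_mono h),
    sB.trans (Set.image_mono h), hr⟩

/-- An orthonormal basis of a Hilbert space of dimension `n` in an arbitrary universe. -/
def uliftBasis (n : ℕ) : OrthonormalBasis (Fin n) ℂ (EuclideanSpace ℂ (ULift.{u} (Fin n))) :=
  (EuclideanSpace.basisFun (ULift.{u} (Fin n)) ℂ).reindex Equiv.ulift

theorem ofReal_le_operatorModulus_abs {F : Set ℝ} {δ : ℝ} (h0 : 0 ∈ F) (hδ : δ ∈ F)
    (hδ0 : 0 ≤ δ) : ENNReal.ofReal δ ≤ operatorModulus.{u} (fun x => |x|) F δ := by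
  have hn : ‖diagOp (uliftBasis.{u} 1) (fun _ => (δ : ℂ)) -
      diagOp (uliftBasis.{u} 1) (fun _ => ((0 : ℝ) : ℂ))‖ = δ := by
    rw [diagOp_sub]
    refine le_antisymm (norm_diagOp_le _ hδ0 fun i => by simp [abs_of_nonneg hδ0]) ?_
    have h := (diagOp (uliftBasis.{u} 1)
      (fun _ => (δ : ℂ) - ((0 : ℝ) : ℂ))).le_opNorm (uliftBasis.{u} 1 0)
    have h2 := norm_diagOp_apply_sq (uliftBasis.{u} 1)
      (fun _ => (δ : ℂ) - ((0 : ℝ) : ℂ)) (uliftBasis.{u} 1 0)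
    rw [(uliftBasis.{u} 1).norm_eq_one, mul_one] at h
    refine le_trans ?_ h
    refine le_of_sq_le_sq ?_ (norm_nonneg _)
    rw [h2]
    simp
  have h := ofReal_norm_sub_le_operatorModulus (uliftBasis.{u} 1) (uliftBasis.{u} 1)
    (f := fun x => |x|) (by fun_prop) (F := F) (v := fun _ => δ) (w := fun _ => 0)
    (fun _ => hδ) (fun _ => h0) hn.le
  simp only [abs_zero, abs_of_nonneg hδ0, hn] at h
  exact h

theorem diagOp_ofReal_mul {H : Type*} [NormedAddCommGroup H] [InnerProductSpace ℂ H] {ι : Type*}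
    [Fintype ι] (b : OrthonormalBasis ι ℂ H) (c : ℝ) (v : ι → ℝ) :
    diagOp b (fun i => ((c * v i : ℝ) : ℂ)) = (c : ℂ) • diagOp b (fun i => (v i : ℂ)) := by
  simp only [diagOp, Finset.smul_sum, smul_smul, Complex.ofReal_mul]

theorem le_operatorModulus_abs_Icc {a δ : ℝ} (hδ : 0 < δ) (hδa : δ ≤ a) :
    ENNReal.ofReal (1 / 2592 * δ * Real.log (2 + Real.posLog (a / δ))) ≤
      operatorModulus.{u} (fun x => |x|) (Set.Icc (-a) a) δ := by
  set x := a / δ with hx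
  have hx1 : 1 ≤ x := (one_le_div hδ).2 hδa
  have hpl : Real.posLog x = Real.log x := max_eq_right (Real.log_nonneg hx1)
  have hy : 0 ≤ Real.log x := Real.log_nonneg hx1
  have hl2 : Real.log 2 < 0.6931471808 := Real.log_two_lt_d9
  have hl2' : 0.6931471803 < Real.log 2 := Real.log_two_gt_d9
  -- The largest N with 2^(4N) ≤ 16x.
  set N := ⌊1 + Real.log x / (4 * Real.log 2)⌋₊ with hN
  have hq : 0 ≤ Real.log x / (4 * Real.log 2) := div_nonneg hy (by linarith)
  have hN1 : 1 ≤ N := Nat.le_floor (by push_cast; linarith)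
  have hN1' : (1 : ℝ) ≤ N := by exact_mod_cast hN1
  have hNle : (N : ℝ) ≤ 1 + Real.log x / (4 * Real.log 2) := Nat.floor_le (by linarith)
  have hNlt : 1 + Real.log x / (4 * Real.log 2) < N + 1 := Nat.lt_floor_add_one _
  have hpow : (2 : ℝ) ^ (4 * N) ≤ 16 * x := by
    rw [← Real.log_le_log_iff (by positivity) (by positivity), Real.log_pow,
      Real.log_mul (by norm_num) (by positivity), show (16 : ℝ) = 2 ^ 4 by norm_num, Real.log_pow]
    push_cast
    have h1 : (N : ℝ) * (4 * Real.log 2) ≤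
        (1 + Real.log x / (4 * Real.log 2)) * (4 * Real.log 2) := by
      gcongr
    rw [add_mul, div_mul_cancel₀ _ (by linarith : 4 * Real.log 2 ≠ 0)] at h1
    linarith
  have hlog : Real.log (2 + Real.log x) ≤ 3 * Real.log (N + 1) := by
    have h1 : Real.log x / 4 ≤ Real.log x / (4 * Real.log 2) := by
      gcongr
      linarith
    -- Here 4(N + 1) > 4 + log x, and 4 ≤ (N + 1)².
    have h2 : 2 + Real.log x ≤ ((N : ℝ) + 1) ^ 3 := by
      have h3 : (4 : ℝ) ≤ ((N : ℝ) + 1) ^ 2 := by nlinarith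
      calc 2 + Real.log x ≤ ((N : ℝ) + 1) * 4 := by linarith
        _ ≤ ((N : ℝ) + 1) * ((N : ℝ) + 1) ^ 2 := by gcongr
        _ = _ := by ring
    calc _ ≤ Real.log (((N : ℝ) + 1) ^ 3) := Real.log_le_log (by linarith) h2
      _ = _ := by rw [Real.log_pow]; norm_cast
  set b := uliftBasis.{u} (4 * N)
  obtain ⟨d, hd1, hd2⟩ := exists_orthonormalBasis_pair hN1 b
  -- This scale keeps the spectrum in [-a, a], as c · 2^(4N) ≤ 16cx = a, and the distance at most 8c
  -- ≤ δ. Then 2592 = 16 · 54 · 3, the last factor coming from `hlog`.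
  set c := δ / 16 with hc
  have hc0 : 0 < c := by positivity
  have nc : ‖(c : ℂ)‖ = c := by rw [Complex.norm_real, Real.norm_of_nonneg hc0.le]
  have hF : ∀ i : Fin (4 * N), c * altPow i ∈ Set.Icc (-a) a := by
    intro i
    rw [Set.mem_Icc, ← abs_le, abs_mul, abs_altPow, abs_of_pos hc0]
    calc c * 2 ^ (i : ℕ) ≤ c * (16 * x) := by
          gcongr
          exact (pow_le_pow_right₀ (by norm_num) i.2.le).trans hpow
      _ = a := by rw [hc, hx]; field_simp
  have hAB : ‖diagOp b (fun i => ((c * altPow i : ℝ) : ℂ)) -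
      diagOp d (fun i => ((c * altPow i : ℝ) : ℂ))‖ ≤ δ := by
    rw [diagOp_ofReal_mul b c fun i => altPow i, diagOp_ofReal_mul d c fun i => altPow i, ← smul_sub,
      norm_smul, nc]
    nlinarith
  refine le_trans (ENNReal.ofReal_le_ofReal ?_) (ofReal_norm_sub_le_operatorModulus b d
    (f := fun x => |x|) (by fun_prop) hF hF hAB)
  simp only [abs_mul, abs_of_pos hc0]
  rw [diagOp_ofReal_mul b c fun i => |altPow i|, diagOp_ofReal_mul d c fun i => |altPow i|,
    ← smul_sub, norm_smul, nc, hpl]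
  calc _ ≤ 1 / 2592 * δ * (3 * Real.log (N + 1)) := by gcongr
    _ = c * (Real.log (N + 1) / 54) := by rw [hc]; ring
    _ ≤ _ := by gcongr

/-- For δ ≥ a the logarithmic factor is just log 2, and the scalar operators δ and 0 suffice. -/
theorem le_operatorModulus_abs_Ici {a δ : ℝ} (ha : 0 < a) (hδ : 0 < δ) :
    ENNReal.ofReal (1 / 2592 * δ * Real.log (2 + Real.posLog (a / δ))) ≤
      operatorModulus.{u} (fun x => |x|) (Set.Ici (-a)) δ := by
  rcases le_total δ a with h | h
  · exact (le_operatorModulus_abs_Icc hδ h).trans (operatorModulus_mono Set.Icc_subset_Ici_self δ)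
  · have hx : a / δ ≤ 1 := (div_le_one hδ).2 h
    have hpl : Real.posLog (a / δ) = 0 :=
      max_eq_left (Real.log_nonpos (by positivity) hx)
    refine le_trans (ENNReal.ofReal_le_ofReal ?_) (ofReal_le_operatorModulus_abs
      (Set.mem_Ici.2 (by linarith)) (Set.mem_Ici.2 (by linarith)) hδ.le)
    rw [hpl, add_zero]
    nlinarith [Real.log_two_lt_d9]

end Lower

end OperatorModulus

end

theorem mainTheorem2 :
    (∃ C₁ C₂ : ℝ, 0 < C₁ ∧ 0 < C₂ ∧ ∀ a δ : ℝ, 0 < a → 0 < δ →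
      (δ ≤ a → ENNReal.ofReal (C₁ * δ * Real.log (2 + Real.posLog (a / δ))) ≤
        OperatorModulus.operatorModulus.{u} (fun x => |x|) (Set.Icc (-a) a) δ) ∧
      ENNReal.ofReal (C₁ * δ * Real.log (2 + Real.posLog (a / δ))) ≤
        OperatorModulus.operatorModulus.{u} (fun x => |x|) (Set.Ici (-a)) δ ∧
      OperatorModulus.operatorModulus.{u} (fun x => |x|) (Set.Icc (-a) a) δ ≤
        OperatorModulus.operatorModulus.{u} (fun x => |x|) (Set.Ici (-a)) δ ∧
      OperatorModulus.operatorModulus.{u} (fun x => |x|) (Set.Ici (-a)) δ ≤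
        ENNReal.ofReal (C₂ * δ * Real.log (2 + Real.posLog (a / δ)))) ∧
    (∃ C : ℝ, 0 < C ∧ ∀ (H : Type u) [NormedAddCommGroup H] [InnerProductSpace ℂ H]
      [CompleteSpace H] (A B : H →L[ℂ] H), IsSelfAdjoint A → IsSelfAdjoint B →
        ‖CFC.abs A - CFC.abs B‖ ≤
          C * ‖A - B‖ * Real.log (2 + Real.log ((‖A‖ + ‖B‖) / ‖A - B‖))) := by
  refine ⟨⟨1 / 2592, 81, by norm_num, by norm_num, fun a δ ha hδ =>
    ⟨fun h => OperatorModulus.le_operatorModulus_abs_Icc hδ h,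
      OperatorModulus.le_operatorModulus_abs_Ici ha hδ,
      OperatorModulus.operatorModulus_mono Set.Icc_subset_Ici_self δ,
      OperatorModulus.operatorModulus_abs_Ici_le ha hδ⟩⟩, 81, by norm_num, ?_⟩
  intro H _ _ _ A B hA hB
  exact OperatorModulus.norm_abs_sub_abs_le hA hB
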